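/- Let $\omega$ be a non-principal ultrafilter on $\mathbb N$. For a finite-dimensional vector space $V\neq 0$ over a field $F$, the group $\mathrm{PGL}(V)=\mathrm{GL}(V)/F^\times$ and its subgroups carry the projective rank metric $$d(\bar x,\bar y)=\inf_{\lambda\in F^\times}\frac{\mathrm{rk}(x-\lambda y)}{\dim V}.$$ For groups $(G_i,d_i)_{i\in\mathbb N}$ with bi-invariant metrics bounded by $1$, the metric ultraproduct $\prod_{i\to\omega}(G_i,d_i)$ is the quotient of $\prod_i G_i$ that makes the pseudometric $d((g_i),(h_i))=\lim_{i\to\omega}d_i(g_i,h_i)$ a metric. Write $\mathrm{PSU}(V,h)$ for the image in $\mathrm{PGL}(V)$ of the group of determinant-one isometries of a non-singular Hermitian form $h$, and $\mathrm{P}\Omega(V,Q)$ for the image in $\mathrm{PGL}(V)$ of the derived group of the isometry group of a non-singular quadratic form $Q$ (one such that no non-zero $v$ with $Q(v)=0$ lies in the radical of the bilinear form $Q(v+w)-Q(v)-Q(w)$). All these groups are given the projective rank metric. **Proposition 4.3.** (a) For each $i\in\mathbb N$ let $F_i$ be a (not necessarily finite) field with a non-trivial automorphism of order $2$, and let $h_i$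 be a non-singular Hermitian form on a finite-dimensional $F_i$-vector space $V_i$, with $\dim V_i\to_\omega\infty$. Then there are even integers $m_i\ge 0$ with $m_i\to_\omega\infty$ and non-singular Hermitian forms $h_i'$ on $F_i^{m_i}$, where $h'_i$ is the standard form $\sum_j\bar x_jy_j$ whenever $F_i$ is finite, such that the metric ultraproducts $\prod_{i\to\omega}(\mathrm{PSU}(V_i,h_i),d)$ and $\prod_{i\to\omega}(\mathrm{PSU}(F_i^{m_i},h_i'),d)$ are isometrically isomorphic as groups. In particular, for finite fields, every metric ultraproduct $\prod_{i\to\omega}(\mathrm{PSU}_{n_i}(F_i),d)$ with $n_i\to_\omega\infty$ is isomorphic to such an ultraproduct with all $n_i$ even. (b) For each $i\in\mathbb N$ let $F_i$ be a finite field and $Q_i$ a non-singular quadratic form on a finite-dimensional $F_i$-vector space $V_i$, with $\dim V_i\to_\omega\infty$. Then there are integers $m_i\ge 0$ with $m_i\to_\omega\infty$ such that the metric ultraproducts $\prod_{i\to\omega}(\mathrm{P}\Omega(V_i,Q_i),d)$ and $\prod_{i\to\omega}(\mathrm{P}\Omega^+_{2m_i}(F_i),d)$ are isometrically isomorphic as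 groups, where $\mathrm{P}\Omega^+_{2m}(F)=\mathrm{P}\Omega(F^m\times F^m,Q)$ for the split form $Q(x,y)=\sum_{j=1}^m x_jy_j$. -/

import Mathlib

open Filter Topology

/-! ### Metric ultraproducts of groups -/

/-- The metric of `G` is bi-invariant and normalized (bounded by `1`). -/
class IsNormalizedBiinvariant (G : Type*) [Group G] [PseudoMetricSpace G] : Prop where
  dist_mul_left' : ∀ a x y : G, dist (a * x) (a * y) = dist x y
  dist_mul_right' : ∀ a x y : G, dist (x * a) (y * a) = dist x y
  dist_le_one' : ∀ x y : G, dist x y ≤ 1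

/-- The full product `∏ i, G i`, to be endowed with the pseudometric
`d x y = lim_{i → ω} d (x i) (y i)`.  This pseudometric only depends on the classes of `x`, `y` in
the abstract ultraproduct. -/
def PreUltraproduct (_ω : Ultrafilter ℕ) (G : ℕ → Type*) : Type _ := ∀ i, G i

namespace PreUltraproduct

variable {ω : Ultrafilter ℕ} {G : ℕ → Type*} [∀ i, Group (G i)]

instance : Group (PreUltraproduct ω G) := inferInstanceAs (Group (∀ i, G i))

@[simp] theorem mul_apply (x y : PreUltraproduct ω G) (i : ℕ) : (x * y) i = x i * y i := rfl
@[simp] theorem inv_apply (x : PreUltraproduct ω G) (i : ℕ) : (x⁻¹) i = (x i)⁻¹ := rfl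
@[simp] theorem one_apply (i : ℕ) : (1 : PreUltraproduct ω G) i = 1 := rfl

variable [∀ i, MetricSpace (G i)] [∀ i, IsNormalizedBiinvariant (G i)]

/-- The `ω`-limit of the distances. -/
noncomputable instance : Dist (PreUltraproduct ω G) :=
  ⟨fun x y => limUnder (ω : Filter ℕ) fun i => dist (x i) (y i)⟩

/-- The limit defining the distance exists. -/
theorem tendsto_dist (x y : PreUltraproduct ω G) :
    Tendsto (fun i => dist (x i) (y i)) ω (𝓝 (dist x y)) := by
  have hK : IsCompact (Set.Icc (0 : ℝ) 1) := isCompact_Icc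
  have hmem : ((ω.map fun i => dist (x i) (y i) : Ultrafilter ℝ) : Filter ℝ)
      ≤ 𝓟 (Set.Icc (0 : ℝ) 1) := by
    rw [le_principal_iff]
    exact Filter.mem_map.2 <| Filter.univ_mem' fun i =>
      ⟨dist_nonneg, IsNormalizedBiinvariant.dist_le_one' (x i) (y i)⟩
  obtain ⟨a, -, ha⟩ := hK.ultrafilter_le_nhds _ hmem
  exact tendsto_nhds_limUnder ⟨a, ha⟩

noncomputable instance : PseudoMetricSpace (PreUltraproduct ω G) where
  dist_self x := tendsto_nhds_unique (tendsto_dist x x) (by simp)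
  dist_comm x y := tendsto_nhds_unique (tendsto_dist x y) (by
    simpa only [dist_comm] using tendsto_dist y x)
  dist_triangle x y z := le_of_tendsto_of_tendsto' (tendsto_dist x z)
    ((tendsto_dist x y).add (tendsto_dist y z)) fun i => dist_triangle (x i) (y i) (z i)

instance : IsNormalizedBiinvariant (PreUltraproduct ω G) where
  dist_mul_left' a x y := tendsto_nhds_unique (tendsto_dist (a * x) (a * y)) (by
    simpa only [mul_apply, IsNormalizedBiinvariant.dist_mul_left'] using tendsto_dist x y)
  dist_mul_right' a x y := tendsto_nhds_unique (tendsto_dist (x * a) (y * a)) (by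
    simpa only [mul_apply, IsNormalizedBiinvariant.dist_mul_right'] using tendsto_dist x y)
  dist_le_one' x y := le_of_tendsto' (tendsto_dist x y) fun i =>
    IsNormalizedBiinvariant.dist_le_one' (x i) (y i)

end PreUltraproduct

/-- A bi-invariant pseudometric makes a group a topological group. -/
theorem IsNormalizedBiinvariant.isTopologicalGroup (G : Type*) [Group G] [PseudoMetricSpace G]
    [IsNormalizedBiinvariant G] : IsTopologicalGroup G where
  continuous_mul := by
    have : LipschitzWith 2 fun p : G × G => p.1 * p.2 := by
      refine LipschitzWith.of_dist_le_mul fun p q => ?_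
      calc dist (p.1 * p.2) (q.1 * q.2)
          ≤ dist (p.1 * p.2) (q.1 * p.2) + dist (q.1 * p.2) (q.1 * q.2) := dist_triangle _ _ _
        _ = dist p.1 q.1 + dist p.2 q.2 := by rw [dist_mul_right', dist_mul_left']
        _ ≤ dist p q + dist p q := add_le_add (le_max_left _ _) (le_max_right _ _)
        _ = (2 : NNReal) * dist p q := by push_cast; ring
    exact this.continuous
  continuous_inv := by
    have : LipschitzWith 1 fun p : G => p⁻¹ := by
      refine LipschitzWith.of_dist_le_mul fun p q => ?_
      rw [← dist_mul_left' p, ← dist_mul_right' q (p * p⁻¹)]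
      simp [dist_comm]
    exact this.continuous

instance (ω : Ultrafilter ℕ) (G : ℕ → Type*) [∀ i, Group (G i)] [∀ i, MetricSpace (G i)]
    [∀ i, IsNormalizedBiinvariant (G i)] : IsTopologicalGroup (PreUltraproduct ω G) :=
  IsNormalizedBiinvariant.isTopologicalGroup _

/-- The metric ultraproduct `∏_{i → ω} (G i, d i)`: the group and metric space obtained from the
product by identifying the sequences at pseudodistance `0`. -/
abbrev MetricUltraproduct (ω : Ultrafilter ℕ) (G : ℕ → Type*) [∀ i, Group (G i)]
    [∀ i, MetricSpace (G i)] [∀ i, IsNormalizedBiinvariant (G i)] : Type _ :=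
  SeparationQuotient (PreUltraproduct ω G)

/-! ### The projective linear group and the projective rank metric -/

section Projective

variable (F V : Type*) [Field F] [AddCommGroup V] [Module F V]

/-- The subgroup of nonzero scalars in `GL(V)`. -/
def scalarSubgroup : Subgroup (LinearMap.GeneralLinearGroup F V) :=
  (Units.map (algebraMap F (Module.End F V) : F →* Module.End F V)).range

variable {F V} in
theorem mem_scalarSubgroup {g : LinearMap.GeneralLinearGroup F V} :
    g ∈ scalarSubgroup F V ↔ ∃ c : Fˣ, (g : Module.End F V) = (c : F) • 1 := by
  constructor
  · rintro ⟨c, rfl⟩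
    exact ⟨c, by simp [Algebra.algebraMap_eq_smul_one]⟩
  · rintro ⟨c, hc⟩
    exact ⟨c, Units.ext (by simp [hc, Algebra.algebraMap_eq_smul_one])⟩

instance : (scalarSubgroup F V).Normal where
  conj_mem g hg x := by
    obtain ⟨c, hc⟩ := mem_scalarSubgroup.1 hg
    exact mem_scalarSubgroup.2 ⟨c, by simp [hc]⟩

/-- `PGL(V)`, the quotient of `GL(V)` by the scalars. -/
def ProjectiveGL : Type _ := LinearMap.GeneralLinearGroup F V ⧸ scalarSubgroup F V

instance : Group (ProjectiveGL F V) :=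
  inferInstanceAs (Group (LinearMap.GeneralLinearGroup F V ⧸ scalarSubgroup F V))

/-- The projection `GL(V) → PGL(V)`. -/
def ProjectiveGL.mk : LinearMap.GeneralLinearGroup F V →* ProjectiveGL F V :=
  QuotientGroup.mk' (scalarSubgroup F V)

variable {F V}

/-- `rk(x - c y)`. -/
noncomputable def rankSub (x y : LinearMap.GeneralLinearGroup F V) (c : Fˣ) : ℕ :=
  Module.finrank F (LinearMap.range ((x : V →ₗ[F] V) - (c : F) • (y : V →ₗ[F] V)))

/-- `inf_{c ∈ Fˣ} rk(x - c y) / dim V`, for `x, y` in `GL(V)`. -/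
noncomputable def projRankDist (x y : LinearMap.GeneralLinearGroup F V) : ℝ :=
  ⨅ c : Fˣ, (rankSub x y c : ℝ) / (Module.finrank F V : ℝ)

theorem projRankDist_le (x y : LinearMap.GeneralLinearGroup F V) (c : Fˣ) :
    projRankDist x y ≤ (rankSub x y c : ℝ) / (Module.finrank F V : ℝ) :=
  ciInf_le ⟨0, by rintro _ ⟨c, rfl⟩; positivity⟩ c

theorem exists_projRankDist_eq (x y : LinearMap.GeneralLinearGroup F V) :
    ∃ c : Fˣ, projRankDist x y = (rankSub x y c : ℝ) / (Module.finrank F V : ℝ) := by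
  refine ⟨Function.argmin (rankSub x y), le_antisymm (projRankDist_le x y _) ?_⟩
  refine le_ciInf fun c => ?_
  have := Function.argmin_le (rankSub x y) c
  gcongr

theorem finrank_range_smul (c : Fˣ) (f : V →ₗ[F] V) :
    Module.finrank F (LinearMap.range ((c : F) • f)) = Module.finrank F (LinearMap.range f) := by
  rw [LinearMap.range_smul f _ c.ne_zero]

theorem finrank_range_units_mul (g : LinearMap.GeneralLinearGroup F V) (f : V →ₗ[F] V) :
    Module.finrank F (LinearMap.range ((g : V →ₗ[F] V) * f)) =
      Module.finrank F (LinearMap.range f) := by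
  have h : (g : V →ₗ[F] V) * f = (g.toLinearEquiv : V →ₗ[F] V) ∘ₗ f := rfl
  rw [h, LinearMap.range_comp]
  exact LinearEquiv.finrank_map_eq g.toLinearEquiv _

theorem finrank_range_mul_units (g : LinearMap.GeneralLinearGroup F V) (f : V →ₗ[F] V) :
    Module.finrank F (LinearMap.range (f * (g : V →ₗ[F] V))) =
      Module.finrank F (LinearMap.range f) := by
  have h : f * (g : V →ₗ[F] V) = f ∘ₗ (g.toLinearEquiv : V →ₗ[F] V) := rfl
  rw [h, LinearMap.range_comp_of_range_eq_top _ (LinearEquiv.range _)]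

theorem projRankDist_self (x : LinearMap.GeneralLinearGroup F V) : projRankDist x x = 0 := by
  refine le_antisymm ((projRankDist_le x x 1).trans ?_) (Real.iInf_nonneg fun c => by positivity)
  have : (x : V →ₗ[F] V) - ((1 : Fˣ) : F) • (x : V →ₗ[F] V) = 0 := by
    rw [Units.val_one, one_smul, sub_self]
  rw [rankSub, this, LinearMap.range_zero]
  simp

theorem projRankDist_comm_le (x y : LinearMap.GeneralLinearGroup F V) :
    projRankDist y x ≤ projRankDist x y := by
  obtain ⟨c, hc⟩ := exists_projRankDist_eq x y
  rw [hc]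
  refine (projRankDist_le y x c⁻¹).trans_eq ?_
  congr 2
  have : (x : V →ₗ[F] V) - (c : F) • (y : V →ₗ[F] V) =
      ((-c : Fˣ) : F) • ((y : V →ₗ[F] V) - ((c⁻¹ : Fˣ) : F) • (x : V →ₗ[F] V)) := by
    rw [smul_sub, smul_smul]
    simp
    abel
  rw [rankSub, rankSub, this, finrank_range_smul]

theorem projRankDist_mul_left (a x y : LinearMap.GeneralLinearGroup F V) :
    projRankDist (a * x) (a * y) = projRankDist x y := by
  have : rankSub (a * x) (a * y) = rankSub x y := by
    funext c
    have e : ((a * x : LinearMap.GeneralLinearGroup F V) : V →ₗ[F] V) -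
        (c : F) • ((a * y : LinearMap.GeneralLinearGroup F V) : V →ₗ[F] V) =
        (a : V →ₗ[F] V) * ((x : V →ₗ[F] V) - (c : F) • (y : V →ₗ[F] V)) := by
      rw [mul_sub, mul_smul_comm, Units.val_mul, Units.val_mul]
    rw [rankSub, rankSub, e, finrank_range_units_mul a]
  rw [projRankDist, projRankDist, this]

theorem projRankDist_mul_right (a x y : LinearMap.GeneralLinearGroup F V) :
    projRankDist (x * a) (y * a) = projRankDist x y := by
  have : rankSub (x * a) (y * a) = rankSub x y := by
    funext c
    have e : ((x * a : LinearMap.GeneralLinearGroup F V) : V →ₗ[F] V) -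
        (c : F) • ((y * a : LinearMap.GeneralLinearGroup F V) : V →ₗ[F] V) =
        ((x : V →ₗ[F] V) - (c : F) • (y : V →ₗ[F] V)) * (a : V →ₗ[F] V) := by
      rw [sub_mul, smul_mul_assoc, Units.val_mul, Units.val_mul]
    rw [rankSub, rankSub, e, finrank_range_mul_units a]
  rw [projRankDist, projRankDist, this]

theorem projRankDist_comm (x y : LinearMap.GeneralLinearGroup F V) :
    projRankDist x y = projRankDist y x :=
  le_antisymm (projRankDist_comm_le y x) (projRankDist_comm_le x y)

theorem ProjectiveGL.mk_surjective : Function.Surjective (ProjectiveGL.mk F V) :=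
  QuotientGroup.mk'_surjective _

variable [FiniteDimensional F V]

theorem projRankDist_triangle (x y z : LinearMap.GeneralLinearGroup F V) :
    projRankDist x z ≤ projRankDist x y + projRankDist y z := by
  obtain ⟨c, hc⟩ := exists_projRankDist_eq x y
  obtain ⟨d, hd⟩ := exists_projRankDist_eq y z
  rw [hc, hd, ← add_div]
  refine (projRankDist_le x z (c * d)).trans ?_
  have key : rankSub x z (c * d) ≤ rankSub x y c + rankSub y z d := by
    have e : (x : V →ₗ[F] V) - ((c * d : Fˣ) : F) • (z : V →ₗ[F] V) =
        ((x : V →ₗ[F] V) - (c : F) • (y : V →ₗ[F] V)) +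
          (c : F) • ((y : V →ₗ[F] V) - (d : F) • (z : V →ₗ[F] V)) := by
      rw [smul_sub, smul_smul]
      simp
    rw [rankSub, rankSub, rankSub, e, ← finrank_range_smul c ((y : V →ₗ[F] V) - _)]
    exact (Submodule.finrank_mono (LinearMap.range_add_le _ _)).trans
      (Submodule.finrank_add_le_finrank_add_finrank _ _)
  have key' : (rankSub x z (c * d) : ℝ) ≤ (rankSub x y c : ℝ) + rankSub y z d := by
    exact_mod_cast key
  gcongr

theorem projRankDist_le_one (x y : LinearMap.GeneralLinearGroup F V) :
    projRankDist x y ≤ 1 :=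
  (projRankDist_le x y 1).trans <| div_le_one_of_le₀
    (by exact_mod_cast Submodule.finrank_le _) (by positivity)

theorem projRankDist_eq_zero_iff (x y : LinearMap.GeneralLinearGroup F V) :
    projRankDist x y = 0 ↔ x⁻¹ * y ∈ scalarSubgroup F V := by
  rw [← projRankDist_mul_left x⁻¹, inv_mul_cancel]
  generalize x⁻¹ * y = g
  constructor
  · intro h
    obtain ⟨c, hc⟩ := exists_projRankDist_eq 1 g
    rw [h] at hc
    have h0 : rankSub 1 g c = 0 := by
      rcases div_eq_zero_iff.1 hc.symm with h1 | h1
      · exact_mod_cast h1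
      · have h2 : Module.finrank F V = 0 := by exact_mod_cast h1
        exact Nat.le_zero.1 ((Submodule.finrank_le _).trans h2.le)
    rw [rankSub, Submodule.finrank_eq_zero, LinearMap.range_eq_bot, sub_eq_zero] at h0
    refine mem_scalarSubgroup.2 ⟨c⁻¹, ?_⟩
    have h1 : (1 : Module.End F V) = (c : F) • (g : Module.End F V) := h0
    rw [h1, smul_smul]
    simp
  · intro h
    obtain ⟨c, hc⟩ := mem_scalarSubgroup.1 h
    refine le_antisymm ((projRankDist_le 1 g c⁻¹).trans ?_)
      (Real.iInf_nonneg fun c => by positivity)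
    have e : ((1 : LinearMap.GeneralLinearGroup F V) : V →ₗ[F] V) -
        ((c⁻¹ : Fˣ) : F) • (g : V →ₗ[F] V) = 0 := by
      rw [hc, smul_smul, Units.inv_mul, one_smul, Units.val_one, sub_self]
    rw [rankSub, e, LinearMap.range_zero]
    simp

/-- The projective rank metric
`d(x̄, ȳ) = inf_{c ∈ Fˣ} rk(x - c y) / dim V` on `PGL(V)`. -/
noncomputable instance : Dist (ProjectiveGL F V) where
  dist := Quotient.lift₂ projRankDist (by
    intro x y x' y' hx hy
    have hx' : projRankDist x x' = 0 :=
      (projRankDist_eq_zero_iff x x').2 (QuotientGroup.leftRel_apply.1 hx)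
    have hy' : projRankDist y y' = 0 :=
      (projRankDist_eq_zero_iff y y').2 (QuotientGroup.leftRel_apply.1 hy)
    have h1 := projRankDist_triangle x x' y
    have h2 := projRankDist_triangle x' y' y
    have h3 := projRankDist_triangle x' x y'
    have h4 := projRankDist_triangle x y y'
    rw [projRankDist_comm x' x] at h3
    rw [projRankDist_comm y' y] at h2
    linarith)

theorem ProjectiveGL.dist_mk (x y : LinearMap.GeneralLinearGroup F V) :
    dist (ProjectiveGL.mk F V x) (ProjectiveGL.mk F V y) = projRankDist x y := rfl

noncomputable instance : MetricSpace (ProjectiveGL F V) where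
  dist_self := ProjectiveGL.mk_surjective.forall.2 fun x => projRankDist_self x
  dist_comm := ProjectiveGL.mk_surjective.forall₂.2 fun x y => projRankDist_comm x y
  dist_triangle := ProjectiveGL.mk_surjective.forall₃.2 fun x y z => projRankDist_triangle x y z
  eq_of_dist_eq_zero := by
    intro x y
    obtain ⟨x, rfl⟩ := ProjectiveGL.mk_surjective x
    obtain ⟨y, rfl⟩ := ProjectiveGL.mk_surjective y
    intro h
    exact QuotientGroup.eq.2 ((projRankDist_eq_zero_iff x y).1 h)

instance : IsNormalizedBiinvariant (ProjectiveGL F V) where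
  dist_mul_left' := ProjectiveGL.mk_surjective.forall₃.2 fun a x y => projRankDist_mul_left a x y
  dist_mul_right' := ProjectiveGL.mk_surjective.forall₃.2 fun a x y => projRankDist_mul_right a x y
  dist_le_one' := ProjectiveGL.mk_surjective.forall₂.2 fun x y => projRankDist_le_one x y

end Projective

/-- A subgroup carries the restricted metric. -/
instance (G : Type*) [Group G] [PseudoMetricSpace G] [IsNormalizedBiinvariant G]
    (H : Subgroup G) : IsNormalizedBiinvariant H where
  dist_mul_left' a x y := IsNormalizedBiinvariant.dist_mul_left' (a : G) x y
  dist_mul_right' a x y := IsNormalizedBiinvariant.dist_mul_right' (a : G) x y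
  dist_le_one' x y := IsNormalizedBiinvariant.dist_le_one' (x : G) y

/-! ### Unitary groups -/

section Unitary

variable {F V : Type*} [Field F] [StarRing F] [AddCommGroup V] [Module F V]

/-- `SU(V, h)`: the linear automorphisms of determinant `1` that preserve the form `h`. -/
def specialUnitarySubgroup (h : V →ₗ⋆[F] V →ₗ[F] F) :
    Subgroup (LinearMap.GeneralLinearGroup F V) where
  carrier := {g | (∀ v w, h ((g : V →ₗ[F] V) v) ((g : V →ₗ[F] V) w) = h v w) ∧
    LinearMap.det (g : V →ₗ[F] V) = 1}
  one_mem' := by simp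
  mul_mem' := by
    rintro a b ⟨ha, ha'⟩ ⟨hb, hb'⟩
    exact ⟨fun v w => by simp [ha, hb], by simp [ha', hb']⟩
  inv_mem' := by
    rintro a ⟨ha, ha'⟩
    have key : ∀ v, (a : V →ₗ[F] V) (((a⁻¹ : LinearMap.GeneralLinearGroup F V) : V →ₗ[F] V) v)
        = v := fun v => by rw [← Module.End.mul_apply, Units.mul_inv, Module.End.one_apply]
    refine ⟨fun v w => by rw [← ha, key, key], ?_⟩
    have := congrArg LinearMap.det a.mul_inv
    rwa [map_mul, ha', one_mul, map_one] at this

/-- `PSU(V, h)`: the image of `SU(V, h)` in `PGL(V)`, that is, `SU(V, h)` modulo its scalars;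
it carries the projective rank metric. -/
def PSU (h : V →ₗ⋆[F] V →ₗ[F] F) : Subgroup (ProjectiveGL F V) :=
  (specialUnitarySubgroup h).map (ProjectiveGL.mk F V)

/-- A non-singular unitary (Hermitian) form. -/
def IsNonsingularHermitian (h : V →ₗ⋆[F] V →ₗ[F] F) : Prop :=
  h.IsSymm ∧ h.Nondegenerate

/-- The Hermitian form `∑ j, x̄_j y_j` on `F ^ m`. -/
def standardHermitianForm (F : Type*) [Field F] [StarRing F] (m : ℕ) :
    (Fin m → F) →ₗ⋆[F] (Fin m → F) →ₗ[F] F :=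
  LinearMap.mk₂'ₛₗ (starRingEnd F) (RingHom.id F) (fun x y => ∑ j, star (x j) * y j)
    (fun x x' y => by simp [add_mul, Finset.sum_add_distrib])
    (fun c x y => by simp [Finset.mul_sum, mul_assoc, starRingEnd_apply])
    (fun x y y' => by simp [mul_add, Finset.sum_add_distrib])
    (fun c x y => by simp [Finset.mul_sum, mul_left_comm])

end Unitary

/-! ### Orthogonal groups -/

section Orthogonal

variable {F V : Type*} [Field F] [AddCommGroup V] [Module F V]

/-- `O(V, Q)`: the linear automorphisms that preserve the quadratic form `Q`. -/
def orthogonalSubgroup (Q : QuadraticForm F V) :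
    Subgroup (LinearMap.GeneralLinearGroup F V) where
  carrier := {g | ∀ v, Q ((g : V →ₗ[F] V) v) = Q v}
  one_mem' := by simp
  mul_mem' := by
    intro a b ha hb v
    simp [ha _, hb _]
  inv_mem' := by
    intro a ha v
    rw [← ha, ← Module.End.mul_apply, Units.mul_inv, Module.End.one_apply]

/-- `Ω(V, Q)`: the derived group of `O(V, Q)`. -/
def omegaSubgroup (Q : QuadraticForm F V) : Subgroup (LinearMap.GeneralLinearGroup F V) :=
  ⁅orthogonalSubgroup Q, orthogonalSubgroup Q⁆

/-- `PΩ(V, Q)`: the image of `Ω(V, Q)` in `PGL(V)`, that is, `Ω(V, Q)` modulo its scalars;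
it carries the projective rank metric. -/
def POmega (Q : QuadraticForm F V) : Subgroup (ProjectiveGL F V) :=
  (omegaSubgroup Q).map (ProjectiveGL.mk F V)

/-- A non-singular quadratic form: the radical `{v | Q v = 0 ∧ ∀ w, φ(v, w) = 0}` of `Q` is
trivial, `φ` being the bilinear form `Q (v + w) - Q v - Q w` associated with `Q`. -/
def IsNonsingularQuadratic (Q : QuadraticForm F V) : Prop :=
  Q.radical = ⊥

/-- The split form `∑ j, x_j y_j` of dimension `2 m`: the vectors `e_j = (ε_j, 0)`,
`f_j = (0, ε_j)` satisfy `Q e_j = Q f_j = 0`, `φ(e_j, f_k) = δ_{jk}`. -/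
def splitQuadraticForm (F : Type*) [Field F] (m : ℕ) :
    QuadraticForm F ((Fin m → F) × (Fin m → F)) :=
  ∑ j, QuadraticMap.linMulLin (LinearMap.proj j ∘ₗ LinearMap.fst F (Fin m → F) (Fin m → F))
    (LinearMap.proj j ∘ₗ LinearMap.snd F (Fin m → F) (Fin m → F))

/-- `PΩ⁺_{2m}(F)`, acting on the split orthogonal space of dimension `2 m`. -/
def POmegaPlus (F : Type*) [Field F] (m : ℕ) :
    Subgroup (ProjectiveGL F ((Fin m → F) × (Fin m → F))) :=
  POmega (splitQuadraticForm F m)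

end Orthogonal

/-! Changing a space by a bounded number of dimensions is invisible to the normalized rank metric in
the limit. Write `V = E ⊥ W` with `E` of the desired shape and `dim W` bounded, and let the group
`A` of `E` act on `V` by `g ↦ g ⊕ 1` (`extendGL`). This changes projective rank distances by at most
`dim W / dim E`, which tends to `0` along `ω`. If in addition every element of the group of `V` is
within `O(1 / dim V)` of some `a ⊕ 1`, then both metric ultraproducts are quotients of `∏ A i` by
the same pseudometric (`exists_isometric_mulEquiv_map_mk`).

Approximation rests on Witt's theorem. For an isometry `g` of `V`, the vectors of `E` that `g` keeps
in `E` form a subspace of codimension at most `dim W`, on which `g` is an isometric injection into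
`E`. It extends to an isometry `τ` of `E`, and `τ ⊕ 1` agrees with `g` in bounded codimension. It
remains to push `τ` into the smaller group at bounded cost. In the unitary case one quasi-reflection
corrects the determinant. In the orthogonal case `τ` is obtained as a product of reflections, and
over a finite field each reflection is congruent modulo `Ω` to one of two fixed ones, so a product
of powers of these two suffices as correction (`exists_mul_mem_omegaSubgroup`). Witt extension by
reflections needs room outside the subspace (`HasAmpleComplement`), which costs four more
dimensions.

The decompositions come from orthogonal families in the Hermitian case, normalized by surjectivity
of the norm over finite fields (`dim W ≤ 1`), and from splitting off hyperbolic planes by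
Chevalley–Warning in the quadratic case (`dim W ≤ 2`). Only `E` needs a nondegenerate polar form, so
odd dimension in characteristic two causes no trouble. -/

/-! ### Comparison of metric ultraproducts -/

/-- Two metric groups that are isometric images of the same group are isometrically isomorphic. -/
theorem exists_isometric_mulEquiv_of_surjective {A X Y : Type*} [Group A] [Group X] [Group Y]
    [MetricSpace X] [MetricSpace Y] (P : A →* X) (Q : A →* Y) (hP : Function.Surjective P)
    (hQ : Function.Surjective Q) (h : ∀ a b, dist (P a) (P b) = dist (Q a) (Q b)) :
    ∃ e : X ≃* Y, Isometry e := by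
  have hker : ∀ a b, P a = P b ↔ Q a = Q b := fun a b => by
    rw [← dist_eq_zero, h, dist_eq_zero]
  -- `s` is merely a set-theoretic section; `Q ∘ s` is multiplicative because `P` and `Q` have the
  -- same fibres.
  let s : X → A := Function.surjInv hP
  have hs : ∀ x, P (s x) = x := Function.surjInv_eq hP
  have key : ∀ a, Q (s (P a)) = Q a := fun a => (hker _ _).1 (hs _)
  let φ : X →* Y := MonoidHom.mk' (fun x => Q (s x)) fun x y => by
    rw [← map_mul, ← hker, map_mul, hs, hs, hs]
  have hφ : Isometry φ := Isometry.of_dist_eq fun x y => by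
    change dist (Q (s x)) (Q (s y)) = _
    rw [← h, hs, hs]
  refine ⟨MulEquiv.ofBijective φ ⟨hφ.injective, fun y => ?_⟩, hφ⟩
  obtain ⟨a, rfl⟩ := hQ y
  exact ⟨P a, key a⟩

namespace MetricUltraproduct

variable {ω : Ultrafilter ℕ} {A G H : ℕ → Type*} [∀ i, Group (A i)] [∀ i, Group (G i)]
  [∀ i, MetricSpace (G i)] [∀ i, IsNormalizedBiinvariant (G i)] [∀ i, Group (H i)]
  [∀ i, MetricSpace (H i)] [∀ i, IsNormalizedBiinvariant (H i)]

/-- The homomorphism into the metric ultraproduct induced by homomorphisms into the factors. -/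
noncomputable def ofHoms (ω : Ultrafilter ℕ) (p : ∀ i, A i →* G i) :
    (∀ i, A i) →* MetricUltraproduct ω G :=
  SeparationQuotient.mkMonoidHom.comp
    (MonoidHom.mk' (fun a => (fun i => p i (a i) : PreUltraproduct ω G))
      fun a b => funext fun i => map_mul (p i) (a i) (b i))

theorem tendsto_dist_ofHoms (p : ∀ i, A i →* G i) (a b : ∀ i, A i) :
    Tendsto (fun i => dist (p i (a i)) (p i (b i))) ω (𝓝 (dist (ofHoms ω p a) (ofHoms ω p b))) :=
  PreUltraproduct.tendsto_dist (ω := ω) (fun i => p i (a i)) (fun i => p i (b i))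

/-- Approximating each coordinate within `ε i` gives an exact preimage, since the errors vanish in
the limit. -/
theorem ofHoms_surjective (p : ∀ i, A i →* G i) {ε : ℕ → ℝ} (hε : Tendsto ε ω (𝓝 0))
    (hp : ∀ᶠ i in ω, ∀ g, ∃ a, dist (p i a) g ≤ ε i) : Function.Surjective (ofHoms ω p) := by
  intro x
  obtain ⟨g, rfl⟩ := SeparationQuotient.surjective_mk x
  classical
  -- The value `1` is used only on an `ω`-negligible set of indices.
  let a : ∀ i, A i := fun i => if h : ∃ a, dist (p i a) (g i) ≤ ε i then h.choose else 1
  refine ⟨a, ?_⟩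
  rw [← dist_eq_zero]
  refine le_antisymm (le_of_tendsto_of_tendsto
    (PreUltraproduct.tendsto_dist (ω := ω) (fun i => p i (a i)) g) hε ?_) dist_nonneg
  filter_upwards [hp] with i hi
  have := (hi (g i)).choose_spec
  simpa only [a, dif_pos (hi (g i))] using this

/-- If `A i` maps homomorphically to `G i` and to `H i` with almost dense images, and the metrics
pulled back to `A i` are almost the same, the metric ultraproducts of the `G i` and of the `H i`
are isometrically isomorphic. -/
theorem exists_isometric_mulEquiv (p : ∀ i, A i →* G i) (q : ∀ i, A i →* H i) {ε : ℕ → ℝ}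
    (hε : Tendsto ε ω (𝓝 0))
    (hd : ∀ᶠ i in ω, ∀ a b, |dist (p i a) (p i b) - dist (q i a) (q i b)| ≤ ε i)
    (hp : ∀ᶠ i in ω, ∀ g, ∃ a, dist (p i a) g ≤ ε i)
    (hq : ∀ᶠ i in ω, ∀ g, ∃ a, dist (q i a) g ≤ ε i) :
    ∃ e : MetricUltraproduct ω G ≃* MetricUltraproduct ω H, Isometry e := by
  refine exists_isometric_mulEquiv_of_surjective (ofHoms ω p) (ofHoms ω q)
    (ofHoms_surjective p hε hp) (ofHoms_surjective q hε hq) fun a b => ?_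
  have h := (tendsto_dist_ofHoms (ω := ω) p a b).sub (tendsto_dist_ofHoms (ω := ω) q a b)
  have h0 : Tendsto (fun i => dist (p i (a i)) (p i (b i)) - dist (q i (a i)) (q i (b i))) ω
      (𝓝 0) := by
    refine squeeze_zero_norm' ?_ hε
    filter_upwards [hd] with i hi using hi (a i) (b i)
  exact sub_eq_zero.1 (tendsto_nhds_unique h h0)

end MetricUltraproduct

/-! ### Rank estimates -/

section RankEstimates

variable {F V : Type*} [Field F] [AddCommGroup V] [Module F V]

/-- Taking the scalar `1` in the infimum, `S` lies in the kernel of `x - y`, so the rank is at most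
`k`. -/
theorem projRankDist_le_of_eqOn [FiniteDimensional F V]
    {x y : LinearMap.GeneralLinearGroup F V} {S : Submodule F V}
    {k : ℕ} (h : ∀ v ∈ S, (x : V →ₗ[F] V) v = (y : V →ₗ[F] V) v)
    (hS : Module.finrank F V ≤ Module.finrank F S + k) :
    projRankDist x y ≤ k / Module.finrank F V := by
  refine (projRankDist_le x y 1).trans ?_
  gcongr
  have h1 : S ≤ LinearMap.ker ((x : V →ₗ[F] V) - ((1 : Fˣ) : F) • (y : V →ₗ[F] V)) := fun v hv => by
    simp [h v hv]
  have h2 := LinearMap.finrank_range_add_finrank_ker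
    ((x : V →ₗ[F] V) - ((1 : Fˣ) : F) • (y : V →ₗ[F] V))
  have h3 := Submodule.finrank_mono h1
  rw [rankSub]
  omega

variable {E W : Type*} [AddCommGroup E] [Module F E] [AddCommGroup W] [Module F W]

/-- The homomorphism `GL(E) → GL(V)`, `g ↦ g ⊕ 1`, for a decomposition `V ≃ E × W`. -/
def extendGL (e : (E × W) ≃ₗ[F] V) :
    LinearMap.GeneralLinearGroup F E →* LinearMap.GeneralLinearGroup F V :=
  Units.map
    { toFun := fun f => e.toLinearMap ∘ₗ f.prodMap LinearMap.id ∘ₗ e.symm.toLinearMap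
      map_one' := by ext; simp
      map_mul' := fun f g => by ext; simp }

@[simp] theorem extendGL_apply (e : (E × W) ≃ₗ[F] V) (g : LinearMap.GeneralLinearGroup F E)
    (x : E) (w : W) :
    (extendGL e g : V →ₗ[F] V) (e (x, w)) = e ((g : E →ₗ[F] E) x, w) := by
  simp [extendGL]

theorem det_extendGL [FiniteDimensional F E] [FiniteDimensional F W] (e : (E × W) ≃ₗ[F] V) (g : LinearMap.GeneralLinearGroup F E) :
    LinearMap.det (extendGL e g : V →ₗ[F] V) = LinearMap.det (g : E →ₗ[F] E) := by
  have h1 : (extendGL e g : V →ₗ[F] V) =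
      e.toLinearMap ∘ₗ (g : E →ₗ[F] E).prodMap LinearMap.id ∘ₗ e.symm.toLinearMap := rfl
  rw [h1, LinearMap.det_conj, LinearMap.det_prodMap, LinearMap.det_id, mul_one]

theorem finrank_map_comp_inl (e : (E × W) ≃ₗ[F] V) (U : Submodule F E) :
    Module.finrank F (U.map (e.toLinearMap ∘ₗ LinearMap.inl F E W)) = Module.finrank F U :=
  (Submodule.equivMapOfInjective (e.toLinearMap ∘ₗ LinearMap.inl F E W)
    (e.injective.comp LinearMap.inl_injective) U).finrank_eq.symm

theorem rankSub_le_rankSub_extendGL [FiniteDimensional F V] (e : (E × W) ≃ₗ[F] V)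
    (x y : LinearMap.GeneralLinearGroup F E) (c : Fˣ) :
    rankSub x y c ≤ rankSub (extendGL e x) (extendGL e y) c := by
  have : FiniteDimensional F (E × W) := e.symm.finiteDimensional
  have h : (LinearMap.range ((x : E →ₗ[F] E) - (c : F) • (y : E →ₗ[F] E))).map
      (e.toLinearMap ∘ₗ LinearMap.inl F E W) ≤ LinearMap.range
        ((extendGL e x : V →ₗ[F] V) - (c : F) • (extendGL e y : V →ₗ[F] V)) := by
    rintro _ ⟨_, ⟨v, rfl⟩, rfl⟩
    refine ⟨e (v, 0), ?_⟩
    rw [LinearMap.sub_apply, LinearMap.smul_apply, extendGL_apply, extendGL_apply, ← map_smul,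
      ← map_sub]
    simp
  have h1 := Submodule.finrank_mono h
  rwa [finrank_map_comp_inl] at h1

/-- The operator splits as `(x - c y) ⊕ (1 - c)`, and the second block has rank at most `dim W`. -/
theorem rankSub_extendGL_le [FiniteDimensional F V] (e : (E × W) ≃ₗ[F] V)
    (x y : LinearMap.GeneralLinearGroup F E) (c : Fˣ) :
    rankSub (extendGL e x) (extendGL e y) c ≤ rankSub x y c + Module.finrank F W := by
  have : FiniteDimensional F (E × W) := e.symm.finiteDimensional
  have : FiniteDimensional F E := .of_injective (LinearMap.inl F E W) LinearMap.inl_injective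
  have : FiniteDimensional F W := .of_injective (LinearMap.inr F E W) LinearMap.inr_injective
  let R := LinearMap.range ((x : E →ₗ[F] E) - (c : F) • (y : E →ₗ[F] E))
  have h : LinearMap.range
        ((extendGL e x : V →ₗ[F] V) - (c : F) • (extendGL e y : V →ₗ[F] V)) ≤
      R.map (e.toLinearMap ∘ₗ LinearMap.inl F E W) ⊔
        LinearMap.range (e.toLinearMap ∘ₗ LinearMap.inr F E W) := by
    rintro _ ⟨v, rfl⟩
    obtain ⟨⟨v, w⟩, rfl⟩ := e.surjective v
    refine Submodule.mem_sup.2 ⟨_, ⟨_, ⟨v, rfl⟩, rfl⟩, _, ⟨w - (c : F) • w, rfl⟩, ?_⟩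
    have h2 : ((extendGL e x : V →ₗ[F] V) - (c : F) • (extendGL e y : V →ₗ[F] V)) (e (v, w)) =
        e ((x : E →ₗ[F] E) v - (c : F) • (y : E →ₗ[F] E) v, w - (c : F) • w) := by
      rw [LinearMap.sub_apply, LinearMap.smul_apply, extendGL_apply, extendGL_apply, ← map_smul,
        ← map_sub]
      simp
    rw [h2]
    simp [← map_add]
  calc _ ≤ _ := Submodule.finrank_mono h
    _ ≤ _ := Submodule.finrank_add_le_finrank_add_finrank _ _
    _ ≤ _ := add_le_add (Submodule.finrank_map_le _ _) (LinearMap.finrank_range_le _)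

/-- Two errors compete: the rank grows by at most `dim W`, while the normalizing dimension grows by
exactly `dim W`. -/
theorem abs_projRankDist_sub_extendGL_le [FiniteDimensional F V]
    (e : (E × W) ≃ₗ[F] V) (hE : 0 < Module.finrank F E)
    (x y : LinearMap.GeneralLinearGroup F E) :
    |projRankDist x y - projRankDist (extendGL e x) (extendGL e y)| ≤
      Module.finrank F W / Module.finrank F E := by
  have : FiniteDimensional F (E × W) := e.symm.finiteDimensional
  have : FiniteDimensional F E := .of_injective (LinearMap.inl F E W) LinearMap.inl_injective
  have : FiniteDimensional F W := .of_injective (LinearMap.inr F E W) LinearMap.inr_injective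
  have hn : (Module.finrank F V : ℝ) = Module.finrank F E + Module.finrank F W := by
    rw [← e.finrank_eq, Module.finrank_prod]
    push_cast
    rfl
  have hE' : (0 : ℝ) < Module.finrank F E := by exact_mod_cast hE
  have hW' : (0 : ℝ) ≤ Module.finrank F W := by positivity
  rw [abs_sub_le_iff]
  constructor
  · obtain ⟨c, hc⟩ := exists_projRankDist_eq (extendGL e x) (extendGL e y)
    have h1 := projRankDist_le x y c
    have h2 : (rankSub x y c : ℝ) ≤ rankSub (extendGL e x) (extendGL e y) c := by
      exact_mod_cast rankSub_le_rankSub_extendGL e x y c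
    have h3 : (rankSub x y c : ℝ) ≤ Module.finrank F E := by
      exact_mod_cast Submodule.finrank_le _
    rw [hc, hn]
    -- A fraction at most `1` does not decrease when the same amount is added to numerator and
    -- denominator.
    have h4 : (rankSub x y c : ℝ) / Module.finrank F E ≤
        (rankSub x y c + Module.finrank F W) / (Module.finrank F E + Module.finrank F W) := by
      rw [div_le_div_iff₀ hE' (by positivity)]
      nlinarith
    have h5 : (rankSub x y c : ℝ) / (Module.finrank F E + Module.finrank F W) ≤
        rankSub (extendGL e x) (extendGL e y) c / (Module.finrank F E + Module.finrank F W) := by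
      gcongr
    have h6 : (Module.finrank F W : ℝ) / (Module.finrank F E + Module.finrank F W) ≤
        Module.finrank F W / Module.finrank F E := by
      gcongr
      linarith
    rw [add_div] at h4
    linarith
  · obtain ⟨c, hc⟩ := exists_projRankDist_eq x y
    have h1 := projRankDist_le (extendGL e x) (extendGL e y) c
    have h2 : (rankSub (extendGL e x) (extendGL e y) c : ℝ) ≤
        rankSub x y c + Module.finrank F W := by
      exact_mod_cast rankSub_extendGL_le e x y c
    have h3 : (rankSub (extendGL e x) (extendGL e y) c : ℝ) / Module.finrank F V ≤
        (rankSub x y c + Module.finrank F W) / Module.finrank F E := by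
      rw [hn]
      gcongr
      linarith
    rw [add_div] at h3
    linarith

/-- If `g` and `g'` act in the same way on `U ≤ E`, the distance of `g` and `g' ⊕ 1` is small. -/
theorem projRankDist_extendGL_le_of_eqOn [FiniteDimensional F V] (e : (E × W) ≃ₗ[F] V)
    {x : LinearMap.GeneralLinearGroup F E} {y : LinearMap.GeneralLinearGroup F V}
    {U : Submodule F E} {k : ℕ}
    (h : ∀ u ∈ U, e ((x : E →ₗ[F] E) u, 0) = (y : V →ₗ[F] V) (e (u, 0)))
    (hU : Module.finrank F V ≤ Module.finrank F U + k) :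
    projRankDist (extendGL e x) y ≤ k / Module.finrank F V := by
  refine projRankDist_le_of_eqOn (S := U.map (e.toLinearMap ∘ₗ LinearMap.inl F E W)) ?_ ?_
  · rintro _ ⟨u, hu, rfl⟩
    simpa using h u hu
  · rwa [finrank_map_comp_inl]

end RankEstimates

/-- If `V i ≃ E i × W i` with `dim W i` bounded, and up to bounded rank the groups `Γ i` on `V i`
and `A i` on `E i` agree, then their projective images have the same metric ultraproducts. -/
theorem exists_isometric_mulEquiv_map_mk {ω : Ultrafilter ℕ} {F V E W : ℕ → Type*}
    [∀ i, Field (F i)] [∀ i, AddCommGroup (V i)] [∀ i, Module (F i) (V i)]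
    [∀ i, FiniteDimensional (F i) (V i)] [∀ i, AddCommGroup (E i)] [∀ i, Module (F i) (E i)]
    [∀ i, FiniteDimensional (F i) (E i)] [∀ i, AddCommGroup (W i)] [∀ i, Module (F i) (W i)]
    (e : ∀ i, (E i × W i) ≃ₗ[F i] V i)
    (A : ∀ i, Subgroup (LinearMap.GeneralLinearGroup (F i) (E i)))
    (Γ : ∀ i, Subgroup (LinearMap.GeneralLinearGroup (F i) (V i)))
    (hA : ∀ i, ∀ g ∈ A i, extendGL (e i) g ∈ Γ i) (C : ℕ)
    (hE : Tendsto (fun i => Module.finrank (F i) (E i)) ω atTop)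
    (hW : ∀ i, Module.finrank (F i) (W i) ≤ C)
    (hΓ : ∀ᶠ i in ω, ∀ g ∈ Γ i, ∃ a ∈ A i,
      projRankDist (extendGL (e i) a) g ≤ C / Module.finrank (F i) (V i)) :
    ∃ φ : MetricUltraproduct ω (fun i => (Γ i).map (ProjectiveGL.mk (F i) (V i))) ≃*
        MetricUltraproduct ω (fun i => (A i).map (ProjectiveGL.mk (F i) (E i))), Isometry φ := by
  let q : ∀ i, A i →* (A i).map (ProjectiveGL.mk (F i) (E i)) := fun i =>
    (ProjectiveGL.mk (F i) (E i)).subgroupMap (A i)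
  let p : ∀ i, A i →* (Γ i).map (ProjectiveGL.mk (F i) (V i)) := fun i =>
    ((ProjectiveGL.mk (F i) (V i)).subgroupMap (Γ i)).comp
      (((extendGL (e i)).comp (A i).subtype).codRestrict _ fun g => hA i g g.2)
  -- One error sequence serves for distortion and for density, since `dim E ≤ dim V`.
  have hε : Tendsto (fun i => (C : ℝ) / Module.finrank (F i) (E i)) ω (𝓝 0) :=
    (tendsto_natCast_atTop_atTop.comp hE).const_div_atTop _
  refine MetricUltraproduct.exists_isometric_mulEquiv p q hε ?_ ?_ ?_
  · filter_upwards [hE.eventually_gt_atTop 0] with i hi a b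
    rw [abs_sub_comm]
    refine (abs_projRankDist_sub_extendGL_le (e i) hi a b).trans ?_
    have := hW i
    gcongr
  · filter_upwards [hE.eventually_gt_atTop 0, hΓ] with i hi hi'
    rintro ⟨_, g, hg, rfl⟩
    obtain ⟨a, ha, hag⟩ := hi' g hg
    refine ⟨⟨a, ha⟩, hag.trans ?_⟩
    have h1 : Module.finrank (F i) (E i) ≤ Module.finrank (F i) (V i) :=
      LinearMap.finrank_le_finrank_of_injective
        (f := (e i).toLinearMap ∘ₗ LinearMap.inl (F i) (E i) (W i))
        ((e i).injective.comp LinearMap.inl_injective)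
    have h2 : (0 : ℝ) < Module.finrank (F i) (E i) := by exact_mod_cast hi
    gcongr
  · refine Eventually.of_forall fun i g => ?_
    obtain ⟨a, rfl⟩ := MonoidHom.subgroupMap_surjective _ _ g
    exact ⟨a, (dist_self (q i a)).le.trans (by positivity)⟩

/-! ### Sesquilinear forms -/

section Sesquilinear

variable {F V : Type*} [Field F] [AddCommGroup V] [Module F V] {σ : F →+* F}

theorem finrank_le_finrank_ker_add {M : Type*} [AddCommGroup M] [Module F M]
    [FiniteDimensional F V] [FiniteDimensional F M] (f : V →ₗ[F] M) :
    Module.finrank F V ≤ Module.finrank F (LinearMap.ker f) + Module.finrank F M := by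
  have := f.finrank_range_add_finrank_ker
  have := LinearMap.range f |>.finrank_le
  omega

/-- A functional vanishing on `H` but not at `v ∉ H` is represented by a vector. -/
theorem exists_orthogonal_apply_ne_zero [FiniteDimensional F V] [RingHomSurjective σ]
    {B : V →ₛₗ[σ] V →ₗ[F] F} (hB : B.SeparatingRight)
    {H : Submodule F V} {v : V} (hv : v ∉ H) : ∃ z, (∀ x ∈ H, B z x = 0) ∧ B z v ≠ 0 := by
  -- The coannihilator of the range is the right radical of `B`, hence trivial; by
  -- finite-dimensional duality every functional is of the form `B z`.
  have hr : LinearMap.range B = ⊤ := by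
    have h1 : (LinearMap.range B).dualCoannihilator = ⊥ := by
      rw [eq_bot_iff]
      intro x hx
      rw [Submodule.mem_dualCoannihilator] at hx
      exact hB x fun y => hx _ ⟨y, rfl⟩
    rw [← Subspace.dualCoannihilator_dualAnnihilator_eq (W := LinearMap.range B), h1]
    simp
  obtain ⟨f, hf, hf'⟩ := Submodule.exists_le_ker_of_notMem hv
  obtain ⟨z, rfl⟩ := LinearMap.range_eq_top.1 hr f
  exact ⟨z, fun x hx => hf' hx, hf⟩

/-- A vector space is not the union of two proper subspaces: if neither `z₁` nor `z₂` works, their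
sum does. -/
theorem exists_orthogonal_apply_ne_zero₂ [FiniteDimensional F V] [RingHomSurjective σ]
    {B : V →ₛₗ[σ] V →ₗ[F] F} (hB : B.SeparatingRight)
    {H : Submodule F V} {v v' : V} (hv : v ∉ H) (hv' : v' ∉ H) :
    ∃ z, (∀ x ∈ H, B z x = 0) ∧ B z v ≠ 0 ∧ B z v' ≠ 0 := by
  obtain ⟨z₁, h₁, h₁'⟩ := exists_orthogonal_apply_ne_zero hB hv
  obtain ⟨z₂, h₂, h₂'⟩ := exists_orthogonal_apply_ne_zero hB hv'
  by_cases h3 : B z₁ v' = 0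
  · by_cases h4 : B z₂ v = 0
    · exact ⟨z₁ + z₂, fun x hx => by simp [h₁ x hx, h₂ x hx], by simpa [h4], by simpa [h3]⟩
    · exact ⟨z₂, h₂, h4, h₂'⟩
  · exact ⟨z₁, h₁, h₁', h3⟩

/-- A finite-dimensional space is the sum of the image of a nondegenerate space and its
orthogonal complement. -/
theorem exists_prodEquiv_orthogonal [FiniteDimensional F V] {E : Type*} [AddCommGroup E]
    [Module F E] [FiniteDimensional F E] (B : V →ₛₗ[σ] V →ₗ[F] F) (ι : E →ₗ[F] V)
    (hι : ∀ y, (∀ x, B (ι x) (ι y) = 0) → y = 0) :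
    ∃ (W : Submodule F V) (e : (E × W) ≃ₗ[F] V), (∀ v, v ∈ W ↔ ∀ x, B (ι x) v = 0) ∧
      ∀ x w, e (x, w) = ι x + w := by
  let b := Module.finBasis F E
  -- The kernel of `T` is the orthogonal complement, and its codimension is at most `dim E`. As it
  -- meets the image of `ι` trivially, a dimension count makes the sum direct and exhaustive.
  let T : V →ₗ[F] (Fin (Module.finrank F E) → F) := LinearMap.pi fun j => B (ι (b j))
  have hT : ∀ v, v ∈ LinearMap.ker T ↔ ∀ x, B (ι x) v = 0 := by
    intro v
    refine ⟨fun h x => ?_, fun h => funext fun j => h _⟩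
    have h0 : ∀ j, B (ι (b j)) v = 0 := congrFun h
    rw [← b.sum_repr x, map_sum, map_sum, LinearMap.sum_apply]
    exact Finset.sum_eq_zero fun j _ => by
      rw [map_smul, map_smulₛₗ, LinearMap.smul_apply, h0, smul_zero]
  have hinj : Function.Injective (ι.coprod (LinearMap.ker T).subtype) := by
    rw [injective_iff_map_eq_zero]
    rintro ⟨x, w⟩ h
    have h' : ι x = -w := eq_neg_of_add_eq_zero_left (by simpa using h)
    have hx : x = 0 := hι x fun y => by rw [h', map_neg, (hT _).1 w.2, neg_zero]
    subst hx
    have : (w : V) = 0 := by simpa using h'.symm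
    simpa using this
  have hdim : Module.finrank F (E × LinearMap.ker T) = Module.finrank F V := by
    refine le_antisymm (LinearMap.finrank_le_finrank_of_injective hinj) ?_
    have := finrank_le_finrank_ker_add T
    rw [Module.finrank_prod]
    simp at this
    omega
  exact ⟨_, LinearEquiv.ofInjectiveOfFinrankEq _ hinj hdim, hT, fun x w => by
    simp [LinearEquiv.ofInjectiveOfFinrankEq]⟩

end Sesquilinear

/-! ### Witt's extension argument -/

/-- Induction for Witt's extension theorem: `K` is a group of automorphisms preserving the
invariant `β`.  If every `β`-preserving extension of the identity of `H` to a further vector is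
induced by an element of `K`, then every `β`-preserving injective map `U → V` is induced by an
element of `K`. -/
theorem exists_mem_eqOn_of_step {F V X : Type*} [Field F] [AddCommGroup V] [Module F V]
    [FiniteDimensional F V] (β : V → V → X) (K : Subgroup (LinearMap.GeneralLinearGroup F V))
    (hK : ∀ g ∈ K, ∀ x y, β ((g : V →ₗ[F] V) x) ((g : V →ₗ[F] V) y) = β x y)
    (U : Submodule F V)
    (step : ∀ H ≤ U, ∀ v ∈ U, v ∉ H → ∀ v' ∉ H, (∀ x ∈ H, β x v' = β x v) → β v' v' = β v v →
      ∃ g ∈ K, (∀ x ∈ H, (g : V →ₗ[F] V) x = x) ∧ (g : V →ₗ[F] V) v = v')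
    (f : V →ₗ[F] V) (hf : ∀ x ∈ U, ∀ y ∈ U, β (f x) (f y) = β x y)
    (hinj : ∀ x ∈ U, f x = 0 → x = 0) :
    ∃ g ∈ K, ∀ x ∈ U, (g : V →ₗ[F] V) x = f x := by
  classical
  obtain ⟨s, rfl⟩ := (inferInstance : IsNoetherian F V).noetherian U
  suffices h : ∀ t : Finset V, t ⊆ s →
      ∃ g ∈ K, ∀ x ∈ Submodule.span F (t : Set V), (g : V →ₗ[F] V) x = f x from h s subset_rfl
  intro t
  induction t using Finset.induction_on with
  | empty => exact fun _ => ⟨1, K.one_mem, by simp +contextual⟩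
  | insert v t hvt ih =>
    intro hts
    rw [Finset.insert_subset_iff] at hts
    obtain ⟨g, hg, hgf⟩ := ih hts.2
    set H := Submodule.span F (t : Set V) with hH
    have hHU : H ≤ Submodule.span F (s : Set V) := Submodule.span_mono (by exact_mod_cast hts.2)
    have hvU : v ∈ Submodule.span F (s : Set V) := Submodule.subset_span (by exact_mod_cast hts.1)
    have hinv : ∀ x, (g : V →ₗ[F] V)
        (((g⁻¹ : LinearMap.GeneralLinearGroup F V) : V →ₗ[F] V) x) = x := fun x => by
      rw [← Module.End.mul_apply, Units.mul_inv, Module.End.one_apply]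
    have hinv' : ∀ x, ((g⁻¹ : LinearMap.GeneralLinearGroup F V) : V →ₗ[F] V)
        ((g : V →ₗ[F] V) x) = x := fun x => by
      rw [← Module.End.mul_apply, Units.inv_mul, Module.End.one_apply]
    by_cases hv : v ∈ H
    · refine ⟨g, hg, ?_⟩
      rwa [Finset.coe_insert, Submodule.span_insert_eq_span hv]
    -- Replacing `f` by `g⁻¹ f` reduces to the case where `f` fixes `H`; it remains to move `v` to
    -- `v'` while fixing `H`.
    set v' := ((g⁻¹ : LinearMap.GeneralLinearGroup F V) : V →ₗ[F] V) (f v) with hv'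
    have hgv' : (g : V →ₗ[F] V) v' = f v := hinv _
    obtain ⟨k, hk, hkH, hkv⟩ := step H hHU v hvU hv v'
      (fun h => hv <| by
        have h1 : f (v - v') = 0 := by rw [map_sub, ← hgf v' h, hgv', sub_self]
        have h2 := hinj _ (Submodule.sub_mem _ hvU (hHU h)) h1
        rwa [sub_eq_zero.1 h2])
      (fun x hx => by rw [← hK g hg, hgf x hx, hgv', hf x (hHU hx) v hvU])
      (by rw [← hK g hg, hgv', hf v hvU v hvU])
    refine ⟨g * k, K.mul_mem hg hk, fun x hx => ?_⟩
    rw [Finset.coe_insert, Submodule.mem_span_insert] at hx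
    obtain ⟨a, z, hz, rfl⟩ := hx
    simp [hkH z hz, hkv, hgf z hz, hgv']

/-! ### Unitary groups: extension of isometries -/

section UnitaryExtension

variable {F V : Type*} [Field F] [StarRing F] [AddCommGroup V] [Module F V]

/-- The isometries of `h` whose determinant has norm one. -/
def formUnitarySubgroup (h : V →ₗ⋆[F] V →ₗ[F] F) :
    Subgroup (LinearMap.GeneralLinearGroup F V) where
  carrier := {g | (∀ v w, h ((g : V →ₗ[F] V) v) ((g : V →ₗ[F] V) w) = h v w) ∧
    LinearMap.det (g : V →ₗ[F] V) * star (LinearMap.det (g : V →ₗ[F] V)) = 1}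
  one_mem' := by simp
  mul_mem' := by
    rintro a b ⟨ha, ha'⟩ ⟨hb, hb'⟩
    refine ⟨fun v w => by simp [ha, hb], ?_⟩
    rw [Units.val_mul, map_mul, star_mul', mul_mul_mul_comm, ha', hb', one_mul]
  inv_mem' := by
    rintro a ⟨ha, ha'⟩
    have key : ∀ v, (a : V →ₗ[F] V) (((a⁻¹ : LinearMap.GeneralLinearGroup F V) : V →ₗ[F] V) v)
        = v := fun v => by rw [← Module.End.mul_apply, Units.mul_inv, Module.End.one_apply]
    refine ⟨fun v w => by rw [← ha, key, key], ?_⟩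
    have h1 := congrArg LinearMap.det a.mul_inv
    rw [map_mul, map_one] at h1
    have h2 := congrArg star h1
    rw [star_mul', star_one] at h2
    linear_combination
      star (LinearMap.det (a : V →ₗ[F] V)) *
        star (LinearMap.det ((a⁻¹ : LinearMap.GeneralLinearGroup F V) : V →ₗ[F] V)) * h1 + h2 -
      LinearMap.det ((a⁻¹ : LinearMap.GeneralLinearGroup F V) : V →ₗ[F] V) *
        star (LinearMap.det ((a⁻¹ : LinearMap.GeneralLinearGroup F V) : V →ₗ[F] V)) * ha'

theorem star_form_apply {h : V →ₗ⋆[F] V →ₗ[F] F} (hs : h.IsSymm) (x y : V) :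
    star (h x y) = h y x := hs.eq x y

variable {E W : Type*} [AddCommGroup E] [Module F E] [FiniteDimensional F E] [AddCommGroup W]
  [Module F W] [FiniteDimensional F W] {h' : E →ₗ⋆[F] E →ₗ[F] F} {k : W →ₗ⋆[F] W →ₗ[F] F}
  {e : (E × W) ≃ₗ[F] V}

theorem extendGL_mem_specialUnitarySubgroup {h : V →ₗ⋆[F] V →ₗ[F] F}
    (he : ∀ x w x' w', h (e (x, w)) (e (x', w')) = h' x x' + k w w')
    {g : LinearMap.GeneralLinearGroup F E} (hg : g ∈ specialUnitarySubgroup h') :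
    extendGL e g ∈ specialUnitarySubgroup h := by
  refine ⟨fun v v' => ?_, by rw [det_extendGL, hg.2]⟩
  obtain ⟨⟨x, w⟩, rfl⟩ := e.surjective v
  obtain ⟨⟨x', w'⟩, rfl⟩ := e.surjective v'
  rw [extendGL_apply, extendGL_apply, he, he, hg.1]

variable [FiniteDimensional F V] {h : V →ₗ⋆[F] V →ₗ[F] F}

/-- The condition on `a` is what cancels the extra terms in `h (g x) (g y)`; it also gives the
determinant norm one, hence invertibility. Isotropic `w` is allowed and yields a unitary
transvection. -/
theorem exists_quasiReflection (hs : h.IsSymm) (w : V) {a : F}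
    (ha : a + star a + a * star a * h w w = 0) :
    ∃ g ∈ formUnitarySubgroup h, (∀ x, (g : V →ₗ[F] V) x = x + (a * h w x) • w) ∧
      LinearMap.det (g : V →ₗ[F] V) = 1 + a * h w w := by
  have hdet : LinearMap.det (LinearMap.transvection (a • h w) w) = 1 + a * h w w := by
    rw [LinearMap.transvection.det]
    simp
  have hb := star_form_apply hs w w
  have hN : (1 + a * h w w) * star (1 + a * h w w) = 1 := by
    rw [star_add, star_mul', hb, star_one]
    linear_combination h w w * ha
  have hu : IsUnit (LinearMap.transvection (a • h w) w) := by
    rw [LinearMap.isUnit_iff_isUnit_det, hdet]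
    exact IsUnit.of_mul_eq_one _ hN
  obtain ⟨g, hg⟩ := hu
  have happ : ∀ x, (g : V →ₗ[F] V) x = x + (a * h w x) • w := fun x => by
    rw [hg, LinearMap.transvection.apply]
    simp
  refine ⟨g, ⟨fun x y => ?_, by rw [hg, hdet, hN]⟩, happ, by rw [hg, hdet]⟩
  have hx : h x w = star (h w x) := (star_form_apply hs w x).symm
  rw [happ, happ]
  simp only [map_add, LinearMap.add_apply, map_smulₛₗ, LinearMap.smul_apply, smul_eq_mul,
    starRingEnd_apply, star_mul', hx, RingHom.id_apply]
  linear_combination star (h w x) * h w y * ha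

/-- With `w = v' - v`, the choice `a = (h w v)⁻¹` sends `v` to `v + w`, and the quasi-reflection
condition becomes equality of `h v v` and `h v' v'`. -/
theorem exists_mem_formUnitarySubgroup_map_eq (hs : h.IsSymm) {v v' : V} (hv : h v' v' = h v v)
    (hne : h (v' - v) v ≠ 0) :
    ∃ g ∈ formUnitarySubgroup h, (g : V →ₗ[F] V) v = v' ∧
      ∀ x, h (v' - v) x = 0 → (g : V →ₗ[F] V) x = x := by
  obtain ⟨w, rfl⟩ : ∃ w, v' = v + w := ⟨v' - v, by abel⟩
  rw [add_sub_cancel_left] at hne ⊢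
  have hvw : h v w = star (h w v) := (star_form_apply hs w v).symm
  have hsum : h w v + star (h w v) + h w w = 0 := by
    simp only [map_add, LinearMap.add_apply] at hv
    linear_combination hv - hvw
  have hne' : star (h w v) ≠ 0 := star_ne_zero.2 hne
  obtain ⟨g, hg, happ, -⟩ := exists_quasiReflection hs w (a := (h w v)⁻¹) (by
    rw [star_inv₀]
    field_simp
    linear_combination hsum)
  refine ⟨g, hg, by rw [happ, inv_mul_cancel₀ hne, one_smul], fun x hx => ?_⟩
  rw [happ, hx, mul_zero, zero_smul, add_zero]

/-- Elements of prescribed trace. -/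
theorem exists_add_star_eq (hF : ∃ a : F, star a ≠ a) {b : F} (hb : star b = b) :
    ∃ t : F, t ≠ 0 ∧ t + star t = b := by
  obtain ⟨a, ha⟩ := hF
  by_cases hb0 : b = 0
  -- For trace zero, `t = 0` is excluded, so a nonzero skew element is taken.
  · exact ⟨a - star a, sub_ne_zero.2 ha.symm, by rw [star_sub, star_star, hb0]; ring⟩
  obtain ⟨u, hu⟩ : ∃ u : F, u + star u ≠ 0 := by
    -- If all traces vanished, `u = 1` would give `2 = 0`, and then `star a = -a = a`.
    by_contra! hcon
    have h1 := hcon 1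
    have h2 := hcon a
    rw [star_one] at h1
    apply ha
    linear_combination h2 - a * h1
  have hstar : star (u + star u) = u + star u := by rw [star_add, star_star, add_comm]
  have hsum : b / (u + star u) * u + star (b / (u + star u) * u) = b := by
    rw [star_mul', star_div₀, hstar, hb]
    field_simp
  refine ⟨b / (u + star u) * u, fun h0 => hb0 ?_, hsum⟩
  rw [← hsum, h0, star_zero, add_zero]

/-- One quasi-reflection along `v' - v` suffices unless `h (v' - v) v = 0`. In that case the detour
`v ↦ v + c z ↦ v'` is used, with `z ⊥ H` not orthogonal to `v` or `v'`; both quasi-reflections are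
along vectors orthogonal to `H`. -/
theorem exists_mem_formUnitarySubgroup_step (hF : ∃ a : F, star a ≠ a) (hh : IsNonsingularHermitian h)
    {H : Submodule F V} {v v' : V} (hv : v ∉ H) (hv' : v' ∉ H)
    (hH : ∀ x ∈ H, h x v' = h x v) (hvv : h v' v' = h v v) :
    ∃ g ∈ formUnitarySubgroup h, (∀ x ∈ H, (g : V →ₗ[F] V) x = x) ∧ (g : V →ₗ[F] V) v = v' := by
  have hs := hh.1
  have hw : ∀ x ∈ H, h (v' - v) x = 0 := fun x hx => by
    rw [← star_form_apply hs, map_sub, hH x hx, sub_self, star_zero]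
  by_cases hne : h (v' - v) v = 0
  swap
  · obtain ⟨g, hg, hgv, hgx⟩ := exists_mem_formUnitarySubgroup_map_eq hs hvv hne
    exact ⟨g, hg, fun x hx => hgx x (hw x hx), hgv⟩
  obtain ⟨z, hz, hzv, hzv'⟩ := exists_orthogonal_apply_ne_zero₂ hh.2.2 hv hv'
  obtain ⟨t, ht0, ht⟩ := exists_add_star_eq hF (b := -h z z) (by
    rw [star_neg, star_form_apply hs])
  have ht0' : star t ≠ 0 := star_ne_zero.2 ht0
  have hvz : h v z = star (h z v) := (star_form_apply hs z v).symm
  have hzv0 : star (h z v) ≠ 0 := star_ne_zero.2 hzv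
  set c := h z v / star t with hc
  have hc0 : c ≠ 0 := div_ne_zero hzv ht0'
  have hc0' : star c ≠ 0 := star_ne_zero.2 hc0
  have hnorm : h (v + c • z) (v + c • z) = h v v := by
    simp only [map_add, LinearMap.add_apply, map_smulₛₗ, LinearMap.smul_apply, smul_eq_mul,
      starRingEnd_apply, RingHom.id_apply, hvz]
    have : c * star (h z v) + star c * h z v + star c * c * h z z = 0 := by
      rw [hc, star_div₀, star_star]
      field_simp
      linear_combination h z v * star (h z v) * ht
    linear_combination this
  obtain ⟨g₁, hg₁, hg₁v, hg₁x⟩ := exists_mem_formUnitarySubgroup_map_eq hs hnorm (by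
    rw [add_sub_cancel_left, map_smulₛₗ, LinearMap.smul_apply, starRingEnd_apply, smul_eq_mul]
    exact mul_ne_zero hc0' hzv)
  have hkey : h (v' - (v + c • z)) (v + c • z) = c * h v' z := by
    have h1 := hnorm
    simp only [map_add, map_sub, LinearMap.add_apply, LinearMap.sub_apply] at h1 hne ⊢
    have h2 : h v' (c • z) = c * h v' z := by simp
    rw [h2]
    linear_combination hne - h1
  have hv'z : h v' z ≠ 0 := by
    rw [← star_form_apply hs]
    exact star_ne_zero.2 hzv'
  obtain ⟨g₂, hg₂, hg₂v, hg₂x⟩ := exists_mem_formUnitarySubgroup_map_eq hs (hvv.trans hnorm.symm) (by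
    rw [hkey]
    exact mul_ne_zero hc0 hv'z)
  refine ⟨g₂ * g₁, mul_mem hg₂ hg₁, fun x hx => ?_, ?_⟩
  · have h1 : (g₁ : V →ₗ[F] V) x = x := hg₁x x (by simp [hz x hx])
    have h2 : (g₂ : V →ₗ[F] V) x = x := hg₂x x (by
      rw [← sub_sub, map_sub, LinearMap.sub_apply, hw x hx]
      simp [hz x hx])
    simp [h1, h2]
  · simp [hg₁v, hg₂v]

/-- Witt's extension theorem for Hermitian forms. -/
theorem exists_mem_formUnitarySubgroup_eqOn (hF : ∃ a : F, star a ≠ a) (hh : IsNonsingularHermitian h)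
    (U : Submodule F V) (f : V →ₗ[F] V) (hf : ∀ x ∈ U, ∀ y ∈ U, h (f x) (f y) = h x y)
    (hinj : ∀ x ∈ U, f x = 0 → x = 0) :
    ∃ g ∈ formUnitarySubgroup h, ∀ x ∈ U, (g : V →ₗ[F] V) x = f x :=
  exists_mem_eqOn_of_step (fun x y => h x y) (formUnitarySubgroup h) (fun _ hg => hg.1) U
    (fun _ _ _ _ hv _ hv' hH hvv => exists_mem_formUnitarySubgroup_step hF hh hv hv' hH hvv) f hf hinj

/-- Every element of `SU(V)` is close to an element of `SU(E)`, for `V = E ⊥ W`. -/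
theorem exists_specialUnitary_projRankDist_le (hF : ∃ a : F, star a ≠ a)
    (hh' : IsNonsingularHermitian h') (hE : ∃ v, h' v v ≠ 0)
    (he : ∀ x w x' w', h (e (x, w)) (e (x', w')) = h' x x' + k w w')
    {g : LinearMap.GeneralLinearGroup F V} (hg : g ∈ specialUnitarySubgroup h) :
    ∃ a ∈ specialUnitarySubgroup h', projRankDist (extendGL e a) g ≤
      (2 * Module.finrank F W + 1 : ℕ) / Module.finrank F V := by
  -- `f` and `T` are the `E`- and `W`-components of `g` on `E`; on `ker T` the map `f` coincides
  -- with `g` and is isometric.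
  let G : E →ₗ[F] E × W := e.symm.toLinearMap ∘ₗ (g : V →ₗ[F] V) ∘ₗ e.toLinearMap ∘ₗ
    LinearMap.inl F E W
  have hG : ∀ x, e (G x) = (g : V →ₗ[F] V) (e (x, 0)) := fun x => by simp [G]
  let f : E →ₗ[F] E := LinearMap.fst F E W ∘ₗ G
  let T : E →ₗ[F] W := LinearMap.snd F E W ∘ₗ G
  have hf : ∀ x, T x = 0 → e (f x, 0) = (g : V →ₗ[F] V) (e (x, 0)) := fun x hx => by
    rw [← hG]
    exact congrArg e (Prod.ext rfl hx.symm)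
  have he0 : ∀ x y, h (e (x, 0)) (e (y, 0)) = h' x y := fun x y => by simp [he]
  have hginj : Function.Injective (g : V →ₗ[F] V) := g.toLinearEquiv.injective
  obtain ⟨τ, hτ, hτf⟩ := exists_mem_formUnitarySubgroup_eqOn hF hh' (LinearMap.ker T) f
    (fun x hx y hy => by rw [← he0, hf x hx, hf y hy, hg.1, he0])
    (fun x hx h0 => by
      have h1 := hf x hx
      rw [h0, Prod.mk_zero_zero, map_zero, eq_comm, map_eq_zero_iff _ hginj,
        map_eq_zero_iff _ e.injective] at h1
      exact congrArg Prod.fst h1)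
  obtain ⟨v, hv⟩ := hE
  set d := LinearMap.det (τ : E →ₗ[F] E) with hd
  have hdN : d * star d = 1 := hτ.2
  have hd0 : d ≠ 0 := left_ne_zero_of_mul_eq_one hdN
  have hb := star_form_apply hh'.1 v v
  -- Here `a` is chosen so that `det r = 1 + a * h' v v = d⁻¹`; admissibility of `a` is exactly `d *
  -- star d = 1`.
  obtain ⟨r, hr, hrapp, hrdet⟩ := exists_quasiReflection hh'.1 v
    (a := (d⁻¹ - 1) / h' v v) (by
      have hd1 : star d = d⁻¹ := eq_inv_of_mul_eq_one_right hdN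
      rw [star_div₀, star_sub, star_inv₀, star_one, hb, hd1]
      field_simp
      ring)
  refine ⟨τ * r, ⟨(mul_mem hτ hr).1, ?_⟩, ?_⟩
  · rw [Units.val_mul, map_mul, hrdet, ← hd]
    field_simp
    ring
  -- On `v^⊥` the correction `r` is trivial. The codimension in `V` is at most `dim W` for `E`, `dim
  -- W` for `T` and `1` for `v`.
  refine projRankDist_extendGL_le_of_eqOn e (U := LinearMap.ker (T.prod (h' v))) ?_ ?_
  · intro u hu
    obtain ⟨hu1, hu2⟩ : T u = 0 ∧ h' v u = 0 := by simpa using hu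
    rw [← hf u hu1, ← hτf u hu1]
    simp [hrapp, hu2]
  · have h1 := finrank_le_finrank_ker_add (T.prod (h' v))
    have h2 := e.finrank_eq
    rw [Module.finrank_prod] at h1 h2
    rw [Module.finrank_self] at h1
    omega

end UnitaryExtension

/-! ### Hermitian forms: orthogonal bases -/

section HermitianBases

/-- The norm of a finite field onto the fixed field of an involution is surjective. -/
theorem exists_mul_star_eq {F : Type*} [Field F] [StarRing F] [Finite F]
    (hF : ∃ a : F, star a ≠ a) {a : F} (ha : star a = a) : ∃ c : F, c * star c = a := by
  by_cases h2 : (2 : F) = 0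
  · have hchar : ringChar F = 2 := CharP.ringChar_of_prime_eq_zero Nat.prime_two (by exact_mod_cast h2)
    obtain ⟨b, rfl⟩ := FiniteField.isSquare_of_char_two hchar a
    refine ⟨b, ?_⟩
    -- In characteristic two the square root of a fixed element is fixed, so it has norm `b * b`.
    have h3 : (star b - b) ^ 2 = 0 := by
      rw [star_mul'] at ha
      linear_combination ha - (star b * b - b * b) * h2
    rw [sub_eq_zero.1 (pow_eq_zero_iff two_ne_zero |>.1 h3)]
  obtain ⟨x, hx⟩ := hF
  set δ := x - star x with hδ
  have hδs : star δ = -δ := by rw [hδ, star_sub, star_star]; ring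
  have hδ0 : δ ≠ 0 := sub_ne_zero.2 hx.symm
  -- Since `δ` is skew, `s + t δ` has norm `s² - D t²` for `s`, `t` in the fixed field; over a
  -- finite field of odd order this binary form represents every element.
  let D : selfAdjoint F := ⟨δ * δ, by rw [selfAdjoint.mem_iff, star_mul', hδs]; ring⟩
  have hD : D ≠ 0 := fun h => hδ0 (mul_self_eq_zero.1 (congrArg Subtype.val h))
  have : Fintype (selfAdjoint F) := Fintype.ofFinite _
  have hcard : Fintype.card (selfAdjoint F) % 2 = 1 := by
    refine FiniteField.odd_card_of_char_ne_two fun h => h2 ?_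
    have h3 : ((2 : ℕ) : selfAdjoint F) = 0 := (ringChar.spec _ _).2 (by rw [h])
    exact congrArg (Subtype.val : selfAdjoint F → F) h3
  open Polynomial in
  obtain ⟨s, t, hst⟩ := FiniteField.exists_root_sum_quadratic
    (f := (X ^ 2 - C (⟨a, ha⟩ : selfAdjoint F) : (selfAdjoint F)[X])) (g := C (-D) * X ^ 2)
    (degree_X_pow_sub_C (by decide) _) (degree_C_mul_X_pow 2 (neg_ne_zero.2 hD)) hcard
  have hst' := congrArg (Subtype.val : selfAdjoint F → F) hst
  simp [D] at hst'
  refine ⟨s + t * δ, ?_⟩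
  have hs : star (s : F) = s := s.2
  have ht : star (t : F) = t := t.2
  rw [star_add, star_mul', hδs, hs, ht]
  linear_combination hst'

variable {F V : Type*} [Field F] [StarRing F] [AddCommGroup V] [Module F V]
  [FiniteDimensional F V] {h : V →ₗ⋆[F] V →ₗ[F] F}

/-- Gram–Schmidt: while vectors are missing, the orthogonal complement of those found is nonzero and
nondegenerate, so it contains an anisotropic vector. Over a finite field this vector can be scaled
to norm `1`. -/
theorem exists_orthogonal_family (hF : ∃ a : F, star a ≠ a) (hh : IsNonsingularHermitian h)
    (n : ℕ) (hn : n ≤ Module.finrank F V) :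
    ∃ v : Fin n → V, (∀ i j, i ≠ j → h (v i) (v j) = 0) ∧ (∀ i, h (v i) (v i) ≠ 0) ∧
      (Finite F → ∀ i, h (v i) (v i) = 1) := by
  have hs := hh.1
  induction n with
  | zero => exact ⟨Fin.elim0, fun i => i.elim0, fun i => i.elim0, fun _ i => i.elim0⟩
  | succ n ih =>
    obtain ⟨v, hv, hv0, hv1⟩ := ih (by omega)
    let T : V →ₗ[F] (Fin n → F) := LinearMap.pi fun j => h (v j)
    have hT : ∀ x, x ∈ LinearMap.ker T ↔ ∀ j, h (v j) x = 0 := fun x => by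
      rw [LinearMap.mem_ker, funext_iff]
      rfl
    obtain ⟨w, hw, hw0⟩ : ∃ w ∈ LinearMap.ker T, w ≠ 0 := by
      refine (Submodule.ne_bot_iff _).1 fun h0 => ?_
      have h1 := finrank_le_finrank_ker_add T
      rw [h0, finrank_bot, Module.finrank_fin_fun] at h1
      omega
    obtain ⟨u, hu, huw⟩ : ∃ u ∈ LinearMap.ker T, h u w ≠ 0 := by
      obtain ⟨u, hu⟩ : ∃ u, h u w ≠ 0 := by
        by_contra! hcon
        exact hw0 (hh.2.2 w hcon)
      -- Projecting `u` to the complement leaves its pairing with `w` unchanged.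
      refine ⟨u - ∑ i, (h (v i) u / h (v i) (v i)) • v i, ?_, ?_⟩
      · rw [hT]
        intro j
        rw [map_sub, map_sum, Finset.sum_eq_single j, map_smul, smul_eq_mul,
          div_mul_cancel₀ _ (hv0 j), sub_self]
        · intro i _ hij
          rw [map_smul, hv j i hij.symm, smul_zero]
        · simp
      · rw [map_sub, map_sum, LinearMap.sub_apply, LinearMap.sum_apply, Finset.sum_eq_zero, sub_zero]
        · exact hu
        · intro i _
          rw [map_smulₛₗ, LinearMap.smul_apply, (hT w).1 hw i, smul_zero]
    obtain ⟨y, hy, hyy⟩ : ∃ y ∈ LinearMap.ker T, h y y ≠ 0 := by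
      by_contra! hcon
      obtain ⟨t, ht⟩ : ∃ t : F, t + star t ≠ 0 := by
        by_contra! hc
        obtain ⟨a, ha⟩ := hF
        have h1 := hc 1
        rw [star_one] at h1
        exact ha (by linear_combination hc a - a * h1)
      have h1 := hcon w hw
      have h2 := hcon u hu
      -- With `w` and `u` isotropic, this vector has norm `t + star t`, which is nonzero.
      have h3 := hcon (w + (t / h w u) • u) (add_mem hw (Submodule.smul_mem _ _ hu))
      have hwu : h w u ≠ 0 := by
        rw [← star_form_apply hs]
        exact star_ne_zero.2 huw
      have hwu' : h u w = star (h w u) := (star_form_apply hs _ _).symm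
      rw [hwu'] at huw
      simp only [map_add, LinearMap.add_apply, map_smulₛₗ, LinearMap.smul_apply, smul_eq_mul,
        starRingEnd_apply, RingHom.id_apply, h1, h2, hwu', star_div₀, zero_add, add_zero,
        mul_zero, div_mul_cancel₀ _ hwu, div_mul_cancel₀ _ huw] at h3
      exact ht ((add_comm _ _).trans h3)
    obtain ⟨y, hy, hyy, hy1⟩ : ∃ y ∈ LinearMap.ker T, h y y ≠ 0 ∧ (Finite F → h y y = 1) := by
      by_cases hfin : Finite F
      · obtain ⟨c, hc⟩ := exists_mul_star_eq hF (star_form_apply hs y y)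
        have h1 : h (c⁻¹ • y) (c⁻¹ • y) = 1 := by
          simp only [map_smulₛₗ, LinearMap.smul_apply, smul_eq_mul, starRingEnd_apply,
            RingHom.id_apply, star_inv₀, ← hc]
          have hc0 : c ≠ 0 := fun h0 => hyy (by rw [← hc, h0, zero_mul])
          have hc0' : star c ≠ 0 := star_ne_zero.2 hc0
          field_simp
        exact ⟨c⁻¹ • y, Submodule.smul_mem _ _ hy, by rw [h1]; exact one_ne_zero, fun _ => h1⟩
      · exact ⟨y, hy, hyy, fun h => absurd h hfin⟩
    rw [hT] at hy
    refine ⟨Fin.cons y v, fun i j hij => ?_, fun i => ?_, fun hfin i => ?_⟩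
    · cases i using Fin.cases with
      | zero =>
        cases j using Fin.cases with
        | zero => exact absurd rfl hij
        | succ j =>
          rw [← star_form_apply hs]
          simp [hy j]
      | succ i =>
        cases j using Fin.cases with
        | zero => exact hy i
        | succ j => exact hv i j fun h => hij (congrArg _ h)
    · cases i using Fin.cases with
      | zero => exact hyy
      | succ i => exact hv0 i
    · cases i using Fin.cases with
      | zero => exact hy1 hfin
      | succ i => exact hv1 hfin i

/-- A Hermitian space contains a nonsingular subspace of prescribed dimension, which may be taken
to be standard over a finite field. -/
theorem exists_hermitian_decomposition (hF : ∃ a : F, star a ≠ a) (hh : IsNonsingularHermitian h)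
    (n : ℕ) (hn : n ≤ Module.finrank F V) :
    ∃ (h' : (Fin n → F) →ₗ⋆[F] (Fin n → F) →ₗ[F] F) (W : Submodule F V)
      (e : ((Fin n → F) × W) ≃ₗ[F] V), IsNonsingularHermitian h' ∧
      (Finite F → h' = standardHermitianForm F n) ∧ (0 < n → ∃ v, h' v v ≠ 0) ∧
      ∀ x w x' w', h (e (x, w)) (e (x', w')) = h' x x' + h.domRestrict₁₂ W W w w' := by
  obtain ⟨v, hv, hv0, hv1⟩ := exists_orthogonal_family hF hh n hn
  have hs := hh.1
  let ι : (Fin n → F) →ₗ[F] V := Fintype.linearCombination F v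
  have hι : ∀ x y, h (ι x) (ι y) = ∑ j, star (x j) * (y j * h (v j) (v j)) := by
    intro x y
    simp only [ι, Fintype.linearCombination_apply, map_sum, LinearMap.sum_apply]
    refine Finset.sum_congr rfl fun i _ => ?_
    rw [Finset.sum_eq_single i]
    · simp [starRingEnd_apply]
      ring
    · intro j _ hji
      simp [hv j i hji]
    · simp
  let h' : (Fin n → F) →ₗ⋆[F] (Fin n → F) →ₗ[F] F := (h ∘ₛₗ ι).compl₂ ι
  have hh' : ∀ x y, h' x y = h (ι x) (ι y) := fun x y => rfl
  have hsymm : h'.IsSymm := ⟨fun x y => hs.eq _ _⟩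
  have hsep : ∀ y, (∀ x, h (ι x) (ι y) = 0) → y = 0 := by
    intro y hy
    funext j
    have h1 := hy (Pi.single j 1)
    rw [hι, Finset.sum_eq_single j] at h1
    · simpa [hv0 j] using h1
    · intro i _ hij
      simp [hij]
    · simp
  obtain ⟨W, e, hW, he⟩ := exists_prodEquiv_orthogonal h ι hsep
  refine ⟨h', W, e, ⟨hsymm, fun x hx => hsep x fun y => ?_, hsep⟩, ?_, ?_, ?_⟩
  · rw [← star_form_apply hs, ← hh', hx, star_zero]
  · intro hfin
    ext x y
    simp [hh', hι, hv1 hfin, standardHermitianForm]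
  · intro hn0
    refine ⟨Pi.single ⟨0, hn0⟩ 1, ?_⟩
    rw [hh', hι, Finset.sum_eq_single ⟨0, hn0⟩]
    · simpa using hv0 _
    · intro i _ hij
      simp [hij]
    · simp
  · intro x w x' w'
    have h1 : h (ι x) w' = 0 := (hW w').1 w'.2 x
    have h2 : h w (ι x') = 0 := by
      rw [← star_form_apply hs, (hW w).1 w.2 x', star_zero]
    have h3 : h.domRestrict₁₂ W W w w' = h w w' := rfl
    rw [he, he, hh', h3]
    simp [h1, h2]

end HermitianBases

/-! ### Metric ultraproducts of unitary groups -/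

theorem exists_even_psu_ultraproduct {ω : Ultrafilter ℕ} (F : ℕ → Type*) [∀ i, Field (F i)]
    [∀ i, StarRing (F i)] (V : ℕ → Type*) [∀ i, AddCommGroup (V i)] [∀ i, Module (F i) (V i)]
    [∀ i, FiniteDimensional (F i) (V i)] (h : ∀ i, V i →ₗ⋆[F i] V i →ₗ[F i] F i)
    (hF : ∀ i, ∃ a : F i, star a ≠ a) (hh : ∀ i, IsNonsingularHermitian (h i))
    (hV : Tendsto (fun i => Module.finrank (F i) (V i)) ω atTop) :
    ∃ (m : ℕ → ℕ) (h' : ∀ i, (Fin (m i) → F i) →ₗ⋆[F i] (Fin (m i) → F i) →ₗ[F i] F i),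
      (∀ i, Even (m i)) ∧ Tendsto m ω atTop ∧ (∀ i, IsNonsingularHermitian (h' i)) ∧
      (∀ i, Finite (F i) → h' i = standardHermitianForm (F i) (m i)) ∧
      ∃ e : MetricUltraproduct ω (fun i => PSU (h i)) ≃* MetricUltraproduct ω (fun i => PSU (h' i)),
        Isometry e := by
  let m : ℕ → ℕ := fun i => 2 * (Module.finrank (F i) (V i) / 2)
  have hm : ∀ i, m i ≤ Module.finrank (F i) (V i) := fun i => Nat.mul_div_le _ _
  have hmtop : Tendsto m ω atTop := by
    refine tendsto_atTop.2 fun N => ?_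
    filter_upwards [hV.eventually_ge_atTop (N + 1)] with i hi
    dsimp only [m]
    omega
  choose h' W e hns hfin hpos he using
    fun i => exists_hermitian_decomposition (hF i) (hh i) (m i) (hm i)
  have hW : ∀ i, Module.finrank (F i) (V i) = m i + Module.finrank (F i) (W i) := fun i => by
    rw [← (e i).finrank_eq, Module.finrank_prod, Module.finrank_fin_fun]
  have hW1 : ∀ i, Module.finrank (F i) (W i) ≤ 1 := fun i => by
    have h1 := hW i
    dsimp only [m] at h1
    omega
  refine ⟨m, h', fun i => even_two_mul _, hmtop, hns, hfin, ?_⟩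
  -- The constant is `3 = 2 * 1 + 1`, as `dim W ≤ 1`.
  exact exists_isometric_mulEquiv_map_mk e (fun i => specialUnitarySubgroup (h' i))
    (fun i => specialUnitarySubgroup (h i))
    (fun i g hg => extendGL_mem_specialUnitarySubgroup (he i) hg) 3 (by simpa using hmtop)
    (fun i => (hW1 i).trans (by norm_num)) (by
      filter_upwards [hmtop.eventually_gt_atTop 0] with i hi g hg
      obtain ⟨a, ha, hag⟩ := exists_specialUnitary_projRankDist_le (hF i) (hns i) (hpos i hi)
        (he i) hg
      refine ⟨a, ha, hag.trans ?_⟩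
      have := hW1 i
      gcongr
      omega)

/-! ### Orthogonal groups: extension of isometries by products of reflections -/

section Reflections

variable {F V : Type*} [Field F] [AddCommGroup V] [Module F V]

open QuadraticMap (polarBilin)

/-- `g` is the reflection `x ↦ x - φ(a, x) / Q(a) • a` along the vector `a` with `Q a ≠ 0`. -/
def IsReflectionAlong (Q : QuadraticForm F V) (a : V) (g : LinearMap.GeneralLinearGroup F V) :
    Prop :=
  Q a ≠ 0 ∧ ∀ x, (g : V →ₗ[F] V) x = x - (polarBilin Q a x / Q a) • a

/-- The group generated by reflections. -/
def reflectionSubgroup (Q : QuadraticForm F V) : Subgroup (LinearMap.GeneralLinearGroup F V) :=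
  Subgroup.closure {g | ∃ a, IsReflectionAlong Q a g}

variable {Q : QuadraticForm F V}

theorem map_add_eq_polarBilin (x y : V) : Q (x + y) = Q x + Q y + polarBilin Q x y :=
  QuadraticMap.map_add Q x y

theorem polarBilin_comm (x y : V) : polarBilin Q x y = polarBilin Q y x :=
  QuadraticMap.polar_comm Q x y

theorem polarBilin_self (x : V) : polarBilin Q x x = 2 * Q x := by
  have := QuadraticMap.polar_self Q x
  rw [nsmul_eq_mul] at this
  exact_mod_cast this

theorem quadraticForm_smul (c : F) (x : V) : Q (c • x) = c * c * Q x := by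
  rw [QuadraticMap.map_smul, smul_eq_mul]

theorem map_add_smul (c : F) (x y : V) :
    Q (x + c • y) = Q x + c * c * Q y + c * polarBilin Q x y := by
  rw [map_add_eq_polarBilin, quadraticForm_smul, map_smul, smul_eq_mul]

/-- As `φ(a, a) = 2 Q(a)`, the functional `φ(a, ·) / Q(a)` takes the value `2` at `a` in every
characteristic; in characteristic two the reflection is a transvection. -/
theorem exists_isReflectionAlong {a : V} (ha : Q a ≠ 0) : ∃ g, IsReflectionAlong Q a g := by
  have h : ((Q a)⁻¹ • polarBilin Q a) a = 2 := by
    rw [LinearMap.smul_apply, polarBilin_self, smul_eq_mul]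
    field_simp
  refine ⟨LinearMap.GeneralLinearGroup.ofLinearEquiv (Module.reflection h), ha, fun x => ?_⟩
  change Module.reflection h x = _
  rw [Module.reflection_apply, LinearMap.smul_apply, smul_eq_mul, div_eq_inv_mul]

namespace IsReflectionAlong

variable {a : V} {g : LinearMap.GeneralLinearGroup F V}

theorem mem_orthogonalSubgroup (hg : IsReflectionAlong Q a g) : g ∈ orthogonalSubgroup Q := by
  intro x
  have ha := hg.1
  rw [hg.2, sub_eq_add_neg, ← neg_smul, map_add_smul, polarBilin_comm x a]
  field_simp
  ring

theorem apply_of_polarBilin_eq_zero (hg : IsReflectionAlong Q a g) {x : V}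
    (hx : polarBilin Q a x = 0) : (g : V →ₗ[F] V) x = x := by
  rw [hg.2, hx, zero_div, zero_smul, sub_zero]

theorem mul_self (hg : IsReflectionAlong Q a g) : g * g = 1 := by
  refine Units.ext (LinearMap.ext fun x => ?_)
  have ha := hg.1
  rw [Units.val_mul, Module.End.mul_apply, hg.2 x, map_sub, map_smul, hg.2 x, hg.2 a,
    polarBilin_self, mul_div_assoc, div_self ha, mul_one, Units.val_one, Module.End.one_apply]
  module

end IsReflectionAlong

theorem reflectionSubgroup_le_orthogonalSubgroup (Q : QuadraticForm F V) :
    reflectionSubgroup Q ≤ orthogonalSubgroup Q :=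
  (Subgroup.closure_le _).2 fun _ ⟨_, hg⟩ => hg.mem_orthogonalSubgroup

theorem polarBilin_apply_apply {g : LinearMap.GeneralLinearGroup F V}
    (hg : g ∈ orthogonalSubgroup Q) (x y : V) :
    polarBilin Q ((g : V →ₗ[F] V) x) ((g : V →ₗ[F] V) y) = polarBilin Q x y := by
  have h1 := hg (x + y)
  rw [map_add, map_add_eq_polarBilin, map_add_eq_polarBilin, hg, hg] at h1
  linear_combination h1

/-- Equality of `Q v` and `Q v'` gives `φ(v' - v, v) = -Q(v' - v)`, so the reflection along `v' - v`
adds `v' - v` to `v`. -/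
theorem exists_reflection_map_eq {v v' : V} (hv : Q v' = Q v) (hne : Q (v' - v) ≠ 0) :
    ∃ g ∈ reflectionSubgroup Q, (g : V →ₗ[F] V) v = v' ∧
      ∀ x, polarBilin Q (v' - v) x = 0 → (g : V →ₗ[F] V) x = x := by
  obtain ⟨g, hg⟩ := exists_isReflectionAlong hne
  refine ⟨g, Subgroup.subset_closure ⟨_, hg⟩, ?_, fun x => hg.apply_of_polarBilin_eq_zero⟩
  have h1 : polarBilin Q (v' - v) v = - Q (v' - v) := by
    have h2 := map_add_eq_polarBilin (Q := Q) (v' - v) v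
    rw [sub_add_cancel, hv] at h2
    linear_combination -h2
  rw [hg.2, h1, neg_div, div_self hne]
  module

/-- For every `w`, the space `U^⊥ ∩ w^⊥` is not totally isotropic for the polar form. -/
def HasAmpleComplement (Q : QuadraticForm F V) (U : Submodule F V) : Prop :=
  ∀ w, ∃ s t, (∀ x ∈ U, polarBilin Q s x = 0) ∧ (∀ x ∈ U, polarBilin Q t x = 0) ∧
    polarBilin Q s w = 0 ∧ polarBilin Q t w = 0 ∧ polarBilin Q s t ≠ 0

/-- If `v' - v` is isotropic, the detour `v ↦ v + c z ↦ v'` now requires `Q z ≠ 0`. Adding to `z`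
vectors orthogonal to `U` and to `v' - v` does not affect its pairings with `H`, `v`, `v'`; if `z`,
`z + s`, `z + t` and `z + s + t` were all isotropic, then `φ(s, t) = 0`. -/
theorem exists_mem_reflectionSubgroup_step [FiniteDimensional F V]
    (hQ : (polarBilin Q).SeparatingRight) {U : Submodule F V} (hU : HasAmpleComplement Q U)
    {H : Submodule F V} (hHU : H ≤ U) {v v' : V} (hvU : v ∈ U) (hv : v ∉ H) (hv' : v' ∉ H)
    (hH : ∀ x ∈ H, polarBilin Q x v' = polarBilin Q x v) (hvv : Q v' = Q v) :
    ∃ g ∈ reflectionSubgroup Q, (∀ x ∈ H, (g : V →ₗ[F] V) x = x) ∧ (g : V →ₗ[F] V) v = v' := by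
  have hw : ∀ x ∈ H, polarBilin Q (v' - v) x = 0 := fun x hx => by
    rw [polarBilin_comm, map_sub, hH x hx, sub_self]
  by_cases hne : Q (v' - v) = 0
  swap
  · obtain ⟨g, hg, hgv, hgx⟩ := exists_reflection_map_eq hvv hne
    exact ⟨g, hg, fun x hx => hgx x (hw x hx), hgv⟩
  obtain ⟨z, hz, hzv, hzv', hQz⟩ : ∃ z, (∀ x ∈ H, polarBilin Q z x = 0) ∧
      polarBilin Q z v ≠ 0 ∧ polarBilin Q z v' ≠ 0 ∧ Q z ≠ 0 := by
    obtain ⟨z, hz, hzv, hzv'⟩ := exists_orthogonal_apply_ne_zero₂ hQ hv hv'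
    obtain ⟨s, t, hs, ht, hsw, htw, hst⟩ := hU (v' - v)
    have key : ∀ y, (∀ x ∈ U, polarBilin Q y x = 0) → polarBilin Q y (v' - v) = 0 →
        (∀ x ∈ H, polarBilin Q (z + y) x = 0) ∧
          polarBilin Q (z + y) v ≠ 0 ∧ polarBilin Q (z + y) v' ≠ 0 := by
      intro y hy hyw
      have hyv := hy v hvU
      have hyv' : polarBilin Q y v' = 0 := by rwa [map_sub, hyv, sub_zero] at hyw
      refine ⟨fun x hx => ?_, ?_, ?_⟩
      · rw [map_add, LinearMap.add_apply, hz x hx, hy x (hHU hx), add_zero]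
      · rwa [map_add, LinearMap.add_apply, hyv, add_zero]
      · rwa [map_add, LinearMap.add_apply, hyv', add_zero]
    by_cases h0 : Q z = 0
    swap
    · exact ⟨z, hz, hzv, hzv', h0⟩
    by_cases h1 : Q (z + s) = 0
    swap
    · obtain ⟨k1, k2, k3⟩ := key s hs hsw
      exact ⟨z + s, k1, k2, k3, h1⟩
    by_cases h2 : Q (z + t) = 0
    swap
    · obtain ⟨k1, k2, k3⟩ := key t ht htw
      exact ⟨z + t, k1, k2, k3, h2⟩
    obtain ⟨k1, k2, k3⟩ := key (s + t)
      (fun x hx => by rw [map_add, LinearMap.add_apply, hs x hx, ht x hx, add_zero])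
      (by rw [map_add, LinearMap.add_apply, hsw, htw, add_zero])
    refine ⟨z + (s + t), k1, k2, k3, fun h3 => hst ?_⟩
    rw [map_add_eq_polarBilin] at h1 h2 h3
    rw [map_add_eq_polarBilin s t, map_add] at h3
    linear_combination h3 - h1 - h2 + h0
  -- Thus `v + c z` is the reflection of `v` along `z`.
  set c := -(polarBilin Q z v) / Q z with hc
  have hc0 : c ≠ 0 := div_ne_zero (neg_ne_zero.2 hzv) hQz
  have hcz : c * Q z = - polarBilin Q z v := by rw [hc, div_mul_cancel₀ _ hQz]
  have hnorm : Q (v + c • z) = Q v := by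
    rw [map_add_smul, polarBilin_comm v z]
    linear_combination c * hcz
  obtain ⟨g₁, hg₁, hg₁v, hg₁x⟩ := exists_reflection_map_eq hnorm (by
    rw [add_sub_cancel_left, quadraticForm_smul]
    exact mul_ne_zero (mul_ne_zero hc0 hc0) hQz)
  have hkey : Q (v' - (v + c • z)) = -c * polarBilin Q z v' := by
    have h1 : v' - (v + c • z) = (v' - v) + (-c) • z := by module
    rw [h1, map_add_smul, hne, polarBilin_comm, map_sub]
    linear_combination c * hcz
  obtain ⟨g₂, hg₂, hg₂v, hg₂x⟩ := exists_reflection_map_eq (hvv.trans hnorm.symm) (by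
    rw [hkey]
    exact mul_ne_zero (neg_ne_zero.2 hc0) hzv')
  refine ⟨g₂ * g₁, mul_mem hg₂ hg₁, fun x hx => ?_, ?_⟩
  · have h1 : (g₁ : V →ₗ[F] V) x = x := hg₁x x (by
      rw [add_sub_cancel_left, map_smul, LinearMap.smul_apply, hz x hx, smul_zero])
    have h2 : (g₂ : V →ₗ[F] V) x = x := hg₂x x (by
      rw [← sub_sub, map_sub, LinearMap.sub_apply, hw x hx, map_smul, LinearMap.smul_apply, hz x hx,
        smul_zero, sub_zero])
    simp [h1, h2]
  · simp [hg₁v, hg₂v]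

/-- Witt's extension theorem for quadratic forms, with an extension that is a product of
reflections. -/
theorem exists_mem_reflectionSubgroup_eqOn [FiniteDimensional F V]
    (hQ : (polarBilin Q).SeparatingRight) {U : Submodule F V} (hU : HasAmpleComplement Q U)
    (f : V →ₗ[F] V) (hf : ∀ x ∈ U, Q (f x) = Q x) (hinj : ∀ x ∈ U, f x = 0 → x = 0) :
    ∃ g ∈ reflectionSubgroup Q, ∀ x ∈ U, (g : V →ₗ[F] V) x = f x := by
  refine exists_mem_eqOn_of_step (fun x y => (polarBilin Q x y, Q x)) (reflectionSubgroup Q)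
    (fun g hg x y => ?_) U (fun H hHU v hvU hv v' hv' hH hvv => ?_) f (fun x hx y hy => ?_) hinj
  · have hg' := reflectionSubgroup_le_orthogonalSubgroup Q hg
    rw [polarBilin_apply_apply hg', hg']
  · exact exists_mem_reflectionSubgroup_step hQ hU hHU hvU hv hv'
      (fun x hx => congrArg Prod.fst (hH x hx)) (congrArg Prod.snd hvv)
  · have h1 := hf (x + y) (add_mem hx hy)
    rw [map_add, map_add_eq_polarBilin, map_add_eq_polarBilin, hf x hx, hf y hy] at h1
    rw [hf x hx, add_left_cancel h1]

/-- A subspace on which the polar form vanishes embeds into its own annihilator, so it has at most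
half the dimension. -/
theorem exists_apply_ne_zero_of_finrank_lt [FiniteDimensional F V]
    (hQ : (polarBilin Q).SeparatingRight) {S : Submodule F V}
    (hS : Module.finrank F V < 2 * Module.finrank F S) :
    ∃ s ∈ S, ∃ t ∈ S, polarBilin Q s t ≠ 0 := by
  by_contra! hcon
  have h1 : S.map (polarBilin Q) ≤ S.dualAnnihilator := by
    rintro _ ⟨s, hs, rfl⟩
    rw [Submodule.mem_dualAnnihilator]
    exact hcon s hs
  have hinj : Function.Injective (polarBilin Q) := by
    rw [injective_iff_map_eq_zero]
    intro x hx
    refine hQ x fun y => ?_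
    rw [polarBilin_comm, hx, LinearMap.zero_apply]
  have h2 : Module.finrank F S ≤ Module.finrank F S.dualAnnihilator := by
    rw [(Submodule.equivMapOfInjective (polarBilin Q) hinj S).finrank_eq]
    exact Submodule.finrank_mono h1
  have h3 : Module.finrank F S + Module.finrank F S.dualAnnihilator = Module.finrank F V :=
    Subspace.finrank_add_finrank_dualAnnihilator_eq S
  omega

/-- `a^⊥ ∩ w^⊥` has codimension at most two, hence more than half the dimension once `dim V > 4`. -/
theorem hasAmpleComplement_span_singleton [FiniteDimensional F V]
    (hQ : (polarBilin Q).SeparatingRight) (hV : 4 < Module.finrank F V) (a : V) :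
    HasAmpleComplement Q (Submodule.span F {a}) := by
  intro w
  have h1 := finrank_le_finrank_ker_add ((polarBilin Q a).prod (polarBilin Q w))
  rw [Module.finrank_prod, Module.finrank_self] at h1
  obtain ⟨s, hs, t, ht, hst⟩ := exists_apply_ne_zero_of_finrank_lt hQ
    (S := LinearMap.ker ((polarBilin Q a).prod (polarBilin Q w))) (by omega)
  have key : ∀ x ∈ LinearMap.ker ((polarBilin Q a).prod (polarBilin Q w)),
      (∀ y ∈ Submodule.span F {a}, polarBilin Q x y = 0) ∧ polarBilin Q x w = 0 := by
    intro x hx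
    obtain ⟨h2, h3⟩ : polarBilin Q a x = 0 ∧ polarBilin Q w x = 0 := by
      rw [LinearMap.mem_ker, LinearMap.prod_apply, Prod.mk_eq_zero] at hx
      exact hx
    refine ⟨fun y hy => ?_, by rw [polarBilin_comm, h3]⟩
    obtain ⟨c, rfl⟩ := Submodule.mem_span_singleton.1 hy
    rw [map_smul, polarBilin_comm, h2, smul_zero]
  exact ⟨s, t, (key s hs).1, (key t ht).1, (key s hs).2, (key t ht).2, hst⟩

/-- Two orthogonal hyperbolic pairs orthogonal to `U` make the complement of `U` ample. -/
theorem hasAmpleComplement_of_hyperbolicPairs {U : Submodule F V} {e₁ f₁ e₂ f₂ : V}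
    (he₁ : Q e₁ = 0) (hf₁ : Q f₁ = 0) (h₁ : polarBilin Q e₁ f₁ = 1) (h₂ : polarBilin Q e₂ f₂ = 1)
    (hee : polarBilin Q e₁ e₂ = 0) (hef : polarBilin Q e₁ f₂ = 0) (hfe : polarBilin Q f₁ e₂ = 0)
    (hff : polarBilin Q f₁ f₂ = 0)
    (hU : ∀ x ∈ U, polarBilin Q e₁ x = 0 ∧ polarBilin Q f₁ x = 0 ∧ polarBilin Q e₂ x = 0 ∧
      polarBilin Q f₂ x = 0) : HasAmpleComplement Q U := by
  intro w
  -- If `w` is orthogonal to `e₁` and `f₁`, these serve directly. Otherwise one of them, `u`, pairs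
  -- with `w` and is used to make multiples of `e₂` and `f₂` orthogonal to `w`; the resulting `s`,
  -- `t` satisfy `φ(s, t) = φ(u, w)²`.
  have key : ∀ u, Q u = 0 → polarBilin Q u e₂ = 0 → polarBilin Q u f₂ = 0 →
      (∀ x ∈ U, polarBilin Q u x = 0) → polarBilin Q u w ≠ 0 →
      ∃ s t, (∀ x ∈ U, polarBilin Q s x = 0) ∧ (∀ x ∈ U, polarBilin Q t x = 0) ∧
        polarBilin Q s w = 0 ∧ polarBilin Q t w = 0 ∧ polarBilin Q s t ≠ 0 := by
    intro u hu hue huf huU huw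
    refine ⟨polarBilin Q u w • e₂ - polarBilin Q e₂ w • u,
      polarBilin Q u w • f₂ - polarBilin Q f₂ w • u, fun x hx => ?_, fun x hx => ?_, ?_, ?_, ?_⟩
    · simp only [map_sub, map_smul, LinearMap.sub_apply, LinearMap.smul_apply, (hU x hx).2.2.1,
        huU x hx, smul_zero, sub_zero]
    · simp only [map_sub, map_smul, LinearMap.sub_apply, LinearMap.smul_apply, (hU x hx).2.2.2,
        huU x hx, smul_zero, sub_zero]
    · simp only [map_sub, map_smul, LinearMap.sub_apply, LinearMap.smul_apply, smul_eq_mul]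
      ring
    · simp only [map_sub, map_smul, LinearMap.sub_apply, LinearMap.smul_apply, smul_eq_mul]
      ring
    · have huu : polarBilin Q u u = 0 := by rw [polarBilin_self, hu, mul_zero]
      simp only [map_sub, map_smul, LinearMap.sub_apply, LinearMap.smul_apply, smul_eq_mul, h₂,
        huf, huu, polarBilin_comm e₂ u, hue, mul_zero, sub_zero, mul_one]
      exact mul_ne_zero huw huw
  by_cases h3 : polarBilin Q e₁ w = 0
  · by_cases h4 : polarBilin Q f₁ w = 0
    · exact ⟨e₁, f₁, fun x hx => (hU x hx).1, fun x hx => (hU x hx).2.1, h3, h4, by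
        rw [h₁]; exact one_ne_zero⟩
    · exact key f₁ hf₁ hfe hff (fun x hx => (hU x hx).2.1) h4
  · exact key e₁ he₁ hee hef (fun x hx => (hU x hx).1) h3

end Reflections

/-! ### Reflections modulo the derived group -/

section ModOmega

variable {F V : Type*} [Field F] [AddCommGroup V] [Module F V] {Q : QuadraticForm F V}

open QuadraticMap (polarBilin)

/-- Reflections along vectors in the same square class are conjugate. -/
theorem IsReflectionAlong.exists_conj [FiniteDimensional F V]
    (hQ : (polarBilin Q).SeparatingRight) (hV : 4 < Module.finrank F V) {a b : V}
    {g k : LinearMap.GeneralLinearGroup F V} (hg : IsReflectionAlong Q a g)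
    (hk : IsReflectionAlong Q b k) {c : F} (hc : Q b = c * c * Q a) :
    ∃ x ∈ orthogonalSubgroup Q, k = x * g * x⁻¹ := by
  have hc0 : c ≠ 0 := by
    rintro rfl
    exact hk.1 (by rw [hc, zero_mul, zero_mul])
  have ha0 : a ≠ 0 := by
    rintro rfl
    exact hg.1 (QuadraticMap.map_zero Q)
  have hb0 : b ≠ 0 := by
    rintro rfl
    exact hk.1 (QuadraticMap.map_zero Q)
  -- The functional `φ` only serves to write down a linear map with `a ↦ c⁻¹ b`. This is isometric
  -- on the line of `a`, and a Witt extension of it conjugates the reflection along `a` into the one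
  -- along `b`.
  obtain ⟨φ, hφ, -⟩ := Submodule.exists_le_ker_of_notMem (p := (⊥ : Submodule F V)) (v := a)
    (by simpa using ha0)
  have hf : ∀ d : F, ((φ a)⁻¹ • φ).smulRight (c⁻¹ • b) (d • a) = (d * c⁻¹) • b := fun d => by
    rw [LinearMap.smulRight_apply, LinearMap.smul_apply, map_smul, smul_eq_mul, smul_eq_mul,
      smul_smul]
    congr 1
    field_simp
  obtain ⟨x, hx, hxa⟩ := exists_mem_reflectionSubgroup_eqOn hQ
    (hasAmpleComplement_span_singleton hQ hV a) (((φ a)⁻¹ • φ).smulRight (c⁻¹ • b))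
    (fun y hy => by
      obtain ⟨d, rfl⟩ := Submodule.mem_span_singleton.1 hy
      rw [hf, quadraticForm_smul, quadraticForm_smul, hc]
      field_simp)
    (fun y hy h0 => by
      obtain ⟨d, rfl⟩ := Submodule.mem_span_singleton.1 hy
      rw [hf] at h0
      rcases smul_eq_zero.1 h0 with h | h
      · rw [(mul_eq_zero.1 h).resolve_right (inv_ne_zero hc0), zero_smul]
      · exact absurd h hb0)
  have hxO := reflectionSubgroup_le_orthogonalSubgroup Q hx
  refine ⟨x, hxO, eq_mul_inv_of_mul_eq (Units.ext (LinearMap.ext fun z => ?_))⟩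
  have hxa' : (x : V →ₗ[F] V) a = c⁻¹ • b := by
    have h1 := hf 1
    rw [one_smul, one_mul] at h1
    rw [hxa a (Submodule.mem_span_singleton_self a), h1]
  have hB : polarBilin Q b ((x : V →ₗ[F] V) z) = c * polarBilin Q a z := by
    rw [← polarBilin_apply_apply hxO a z, hxa', map_smul, LinearMap.smul_apply, smul_eq_mul,
      mul_inv_cancel_left₀ hc0]
  rw [Units.val_mul, Units.val_mul, Module.End.mul_apply, Module.End.mul_apply, hk.2, hg.2,
    map_sub, map_smul, hxa', hB, hc, smul_smul]
  congr 2
  have := hg.1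
  field_simp

/-- A finite field has at most two nonzero square classes, and only one in characteristic two, where
`δ = 1` will do. -/
theorem FiniteField.exists_forall_eq_mul_self (F : Type*) [Field F] [Finite F] :
    ∃ δ : F, δ ≠ 0 ∧ ∀ x : F, ∃ c, x = c * c * 1 ∨ x = c * c * δ := by
  have : Fintype F := Fintype.ofFinite F
  classical
  by_cases h2 : ringChar F = 2
  · refine ⟨1, one_ne_zero, fun x => ?_⟩
    obtain ⟨c, rfl⟩ := FiniteField.isSquare_of_char_two h2 x
    exact ⟨c, Or.inl (mul_one _).symm⟩
  · obtain ⟨δ, hδ⟩ := FiniteField.exists_nonsquare h2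
    have hδ0 : δ ≠ 0 := by
      rintro rfl
      exact hδ IsSquare.zero
    refine ⟨δ, hδ0, fun x => ?_⟩
    by_cases hx : IsSquare x
    · obtain ⟨c, rfl⟩ := hx
      exact ⟨c, Or.inl (mul_one _).symm⟩
    · have hx0 : x ≠ 0 := by
        rintro rfl
        exact hx IsSquare.zero
      have h1 : quadraticChar F (x * δ) = 1 := by
        rw [map_mul, quadraticChar_neg_one_iff_not_isSquare.2 hx,
          quadraticChar_neg_one_iff_not_isSquare.2 hδ]
        norm_num
      obtain ⟨c, hc⟩ := (quadraticChar_one_iff_isSquare (mul_ne_zero hx0 hδ0)).1 h1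
      refine ⟨c / δ, Or.inr ?_⟩
      field_simp
      linear_combination hc

theorem pow_apply_eq_self {g : LinearMap.GeneralLinearGroup F V} {x : V}
    (h : (g : V →ₗ[F] V) x = x) (n : ℕ) :
    ((g ^ n : LinearMap.GeneralLinearGroup F V) : V →ₗ[F] V) x = x := by
  rw [Units.val_pow_eq_pow_val, Module.End.pow_apply]
  exact Function.iterate_fixed h n

/-- Over a finite field, products of reflections lie in `Ω` up to elements fixing a subspace of
codimension two. -/
theorem exists_mul_mem_omegaSubgroup [FiniteDimensional F V] [Finite F]
    (hQ : (polarBilin Q).SeparatingRight) (hV : 4 < Module.finrank F V)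
    (hrep : ∀ c, ∃ a, Q a = c) :
    ∃ a₁ a₂, ∀ g ∈ reflectionSubgroup Q, ∃ t : LinearMap.GeneralLinearGroup F V,
      (∀ x, polarBilin Q a₁ x = 0 → polarBilin Q a₂ x = 0 → (t : V →ₗ[F] V) x = x) ∧
      g * t ∈ omegaSubgroup Q := by
  obtain ⟨δ, hδ0, hδ⟩ := FiniteField.exists_forall_eq_mul_self F
  obtain ⟨a₁, ha₁⟩ := hrep 1
  obtain ⟨a₂, ha₂⟩ := hrep δ
  obtain ⟨r₁, hr₁⟩ := exists_isReflectionAlong (Q := Q) (a := a₁) (by rw [ha₁]; exact one_ne_zero)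
  obtain ⟨r₂, hr₂⟩ := exists_isReflectionAlong (Q := Q) (a := a₂) (by rwa [ha₂])
  let ψ : orthogonalSubgroup Q →* Abelianization (orthogonalSubgroup Q) := Abelianization.of
  let s₁ : orthogonalSubgroup Q := ⟨r₁, hr₁.mem_orthogonalSubgroup⟩
  let s₂ : orthogonalSubgroup Q := ⟨r₂, hr₂.mem_orthogonalSubgroup⟩
  have hs₁ : ψ s₁ * ψ s₁ = 1 := by
    rw [← map_mul, show s₁ * s₁ = 1 from Subtype.ext hr₁.mul_self, map_one]
  have hs₂ : ψ s₂ * ψ s₂ = 1 := by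
    rw [← map_mul, show s₂ * s₂ = 1 from Subtype.ext hr₂.mul_self, map_one]
  have hconj : ∀ (k s : LinearMap.GeneralLinearGroup F V) (hk : k ∈ orthogonalSubgroup Q)
      (hs : s ∈ orthogonalSubgroup Q), (∃ x ∈ orthogonalSubgroup Q, k = x * s * x⁻¹) →
      ψ ⟨k, hk⟩ = ψ ⟨s, hs⟩ := by
    rintro k s hk hs ⟨x, hx, rfl⟩
    have h1 : (⟨x * s * x⁻¹, hk⟩ : orthogonalSubgroup Q) = ⟨x, hx⟩ * ⟨s, hs⟩ * ⟨x, hx⟩⁻¹ := rfl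
    rw [h1, map_mul, map_mul, map_inv, mul_comm (ψ ⟨x, hx⟩), mul_inv_cancel_right]
  -- Modulo `Ω` each reflection is conjugate to `r₁` or `r₂`, according to the square class of `Q
  -- b`.
  have key : ∀ g ∈ reflectionSubgroup Q, ∃ (hg : g ∈ orthogonalSubgroup Q) (i j : ℕ),
      ψ ⟨g, hg⟩ = ψ s₁ ^ i * ψ s₂ ^ j := by
    intro g hg
    induction hg using Subgroup.closure_induction with
    | mem k hk =>
      obtain ⟨b, hk⟩ := hk
      refine ⟨hk.mem_orthogonalSubgroup, ?_⟩
      obtain ⟨c, hc | hc⟩ := hδ (Q b)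
      · refine ⟨1, 0, ?_⟩
        rw [pow_one, pow_zero, mul_one]
        exact hconj _ _ _ _ (hr₁.exists_conj hQ hV hk (by rw [hc, ha₁]))
      · refine ⟨0, 1, ?_⟩
        rw [pow_one, pow_zero, one_mul]
        exact hconj _ _ _ _ (hr₂.exists_conj hQ hV hk (by rw [hc, ha₂]))
    | one => exact ⟨one_mem _, 0, 0, by rw [pow_zero, pow_zero, mul_one]; exact map_one ψ⟩
    | mul x y _ _ hx hy =>
      obtain ⟨hx, i, j, hij⟩ := hx
      obtain ⟨hy, i', j', hij'⟩ := hy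
      refine ⟨mul_mem hx hy, i + i', j + j', ?_⟩
      rw [pow_add, pow_add, mul_mul_mul_comm, ← hij, ← hij', ← map_mul]
      rfl
    | inv x _ hx =>
      obtain ⟨hx, i, j, hij⟩ := hx
      refine ⟨inv_mem hx, i, j, ?_⟩
      have h1 : (⟨x⁻¹, inv_mem hx⟩ : orthogonalSubgroup Q) = ⟨x, hx⟩⁻¹ := rfl
      rw [h1, map_inv, hij, mul_inv, ← inv_pow, ← inv_pow, inv_eq_of_mul_eq_one_left hs₁,
        inv_eq_of_mul_eq_one_left hs₂]
  refine ⟨a₁, a₂, fun g hg => ?_⟩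
  obtain ⟨hgO, i, j, hij⟩ := key g hg
  -- The classes of `r₁` and `r₂` are commuting involutions, so the same exponents cancel the class
  -- of `g`.
  refine ⟨r₁ ^ i * r₂ ^ j, fun x hx₁ hx₂ => ?_, ?_⟩
  · rw [Units.val_mul, Module.End.mul_apply,
      pow_apply_eq_self (hr₂.apply_of_polarBilin_eq_zero hx₂),
      pow_apply_eq_self (hr₁.apply_of_polarBilin_eq_zero hx₁)]
  · rw [omegaSubgroup, ← Subgroup.map_subtype_commutator]
    refine ⟨⟨g, hgO⟩ * (s₁ ^ i * s₂ ^ j), ?_, rfl⟩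
    rw [← Abelianization.ker_of]
    change ψ _ = 1
    rw [map_mul, map_mul, map_pow, map_pow, hij, mul_mul_mul_comm, ← mul_pow, ← mul_pow, hs₁, hs₂,
      one_pow, one_pow, mul_one]

end ModOmega

/-! ### Approximation by `Ω` of a nondegenerate summand -/

section OmegaApproximation

variable {F V E W : Type*} [Field F] [AddCommGroup V] [Module F V] [AddCommGroup E] [Module F E]
  [AddCommGroup W] [Module F W] {Q : QuadraticForm F V} {QE : QuadraticForm F E}
  {QW : QuadraticForm F W} {e : (E × W) ≃ₗ[F] V}

open QuadraticMap (polarBilin)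

theorem extendGL_mem_omegaSubgroup (he : ∀ x w, Q (e (x, w)) = QE x + QW w)
    {g : LinearMap.GeneralLinearGroup F E} (hg : g ∈ omegaSubgroup QE) :
    extendGL e g ∈ omegaSubgroup Q := by
  have h1 : (orthogonalSubgroup QE).map (extendGL e) ≤ orthogonalSubgroup Q := by
    rintro _ ⟨k, hk, rfl⟩ v
    obtain ⟨⟨x, w⟩, rfl⟩ := e.surjective v
    rw [extendGL_apply, he, he, hk]
  have h2 := Subgroup.mem_map_of_mem (extendGL e) hg
  rw [omegaSubgroup, Subgroup.map_commutator] at h2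
  exact Subgroup.commutator_mono h1 h1 h2

/-- Every isometry of `V = E ⊥ W` is close to an element of `Ω(E)`. -/
theorem exists_omega_projRankDist_le [Finite F] [FiniteDimensional F V] [FiniteDimensional F E]
    [FiniteDimensional F W] (hQ : (polarBilin QE).SeparatingRight)
    (hE : 4 < Module.finrank F E) (hrep : ∀ c, ∃ a, QE a = c) {e₁ f₁ e₂ f₂ : E}
    (he₁ : QE e₁ = 0) (hf₁ : QE f₁ = 0) (h₁ : polarBilin QE e₁ f₁ = 1)
    (h₂ : polarBilin QE e₂ f₂ = 1) (hee : polarBilin QE e₁ e₂ = 0)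
    (hef : polarBilin QE e₁ f₂ = 0) (hfe : polarBilin QE f₁ e₂ = 0)
    (hff : polarBilin QE f₁ f₂ = 0) (he : ∀ x w, Q (e (x, w)) = QE x + QW w)
    {g : LinearMap.GeneralLinearGroup F V} (hg : g ∈ orthogonalSubgroup Q) :
    ∃ a ∈ omegaSubgroup QE, projRankDist (extendGL e a) g ≤
      (2 * Module.finrank F W + 6 : ℕ) / Module.finrank F V := by
  obtain ⟨a₁, a₂, ha⟩ := exists_mul_mem_omegaSubgroup hQ hE hrep
  let G : E →ₗ[F] E × W := e.symm.toLinearMap ∘ₗ (g : V →ₗ[F] V) ∘ₗ e.toLinearMap ∘ₗ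
    LinearMap.inl F E W
  have hG : ∀ x, e (G x) = (g : V →ₗ[F] V) (e (x, 0)) := fun x => by simp [G]
  let f : E →ₗ[F] E := LinearMap.fst F E W ∘ₗ G
  let T : E →ₗ[F] W := LinearMap.snd F E W ∘ₗ G
  -- `ker φ` leaves both hyperbolic pairs free for Witt extension, and on `ker ψ` the correction
  -- into `Ω` is trivial. Together they add `4 + 2` to the codimension `2 dim W`.
  let φ : E →ₗ[F] (Fin 4 → F) := LinearMap.pi fun j => polarBilin QE (![e₁, f₁, e₂, f₂] j)
  let ψ : E →ₗ[F] (Fin 2 → F) := LinearMap.pi fun j => polarBilin QE (![a₁, a₂] j)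
  have hf : ∀ x, T x = 0 → e (f x, 0) = (g : V →ₗ[F] V) (e (x, 0)) := fun x hx => by
    rw [← hG]
    exact congrArg e (Prod.ext rfl hx.symm)
  have he0 : ∀ x, Q (e (x, 0)) = QE x := fun x => by rw [he, QuadraticMap.map_zero, add_zero]
  have hginj : Function.Injective (g : V →ₗ[F] V) := g.toLinearEquiv.injective
  have hTφ : ∀ x ∈ LinearMap.ker (T.prod φ), T x = 0 ∧ φ x = 0 := fun x hx => by
    rwa [LinearMap.mem_ker, LinearMap.prod_apply, Prod.mk_eq_zero] at hx
  obtain ⟨τ, hτ, hτf⟩ := exists_mem_reflectionSubgroup_eqOn hQ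
    (U := LinearMap.ker (T.prod φ))
    (hasAmpleComplement_of_hyperbolicPairs he₁ hf₁ h₁ h₂ hee hef hfe hff fun x hx =>
      ⟨congrFun (hTφ x hx).2 0, congrFun (hTφ x hx).2 1, congrFun (hTφ x hx).2 2,
        congrFun (hTφ x hx).2 3⟩) f
    (fun x hx => by rw [← he0, hf x (hTφ x hx).1, hg, he0])
    (fun x hx h0 => by
      have h3 := hf x (hTφ x hx).1
      rw [h0, Prod.mk_zero_zero, map_zero, eq_comm, map_eq_zero_iff _ hginj,
        map_eq_zero_iff _ e.injective] at h3
      exact congrArg Prod.fst h3)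
  obtain ⟨t, ht, hτt⟩ := ha τ hτ
  refine ⟨τ * t, hτt, projRankDist_extendGL_le_of_eqOn e
    (U := LinearMap.ker ((T.prod φ).prod ψ)) (fun u hu => ?_) ?_⟩
  · obtain ⟨hu₁, hu₂⟩ : u ∈ LinearMap.ker (T.prod φ) ∧ ψ u = 0 := by
      rwa [LinearMap.mem_ker, LinearMap.prod_apply, Prod.mk_eq_zero] at hu
    rw [Units.val_mul, Module.End.mul_apply, ht u (congrFun hu₂ 0) (congrFun hu₂ 1), hτf u hu₁,
      hf u (hTφ u hu₁).1]
  · have h3 := finrank_le_finrank_ker_add ((T.prod φ).prod ψ)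
    have h4 := e.finrank_eq
    rw [Module.finrank_prod] at h4
    rw [Module.finrank_prod, Module.finrank_prod, Module.finrank_fin_fun,
      Module.finrank_fin_fun] at h3
    omega

end OmegaApproximation

/-! ### Split quadratic forms -/

section Split

variable {F V : Type*} [Field F] [AddCommGroup V] [Module F V]

open QuadraticMap (polarBilin)

theorem splitQuadraticForm_apply (m : ℕ) (x : (Fin m → F) × (Fin m → F)) :
    splitQuadraticForm F m x = ∑ j, x.1 j * x.2 j := by
  simp [splitQuadraticForm]

theorem polarBilin_splitQuadraticForm (m : ℕ) (x y : (Fin m → F) × (Fin m → F)) :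
    polarBilin (splitQuadraticForm F m) x y = ∑ j, (x.1 j * y.2 j + y.1 j * x.2 j) := by
  have h := map_add_eq_polarBilin (Q := splitQuadraticForm F m) x y
  have h' : polarBilin (splitQuadraticForm F m) x y = splitQuadraticForm F m (x + y) -
      splitQuadraticForm F m x - splitQuadraticForm F m y := by
    rw [h]
    ring
  rw [h', splitQuadraticForm_apply, splitQuadraticForm_apply, splitQuadraticForm_apply,
    ← Finset.sum_sub_distrib, ← Finset.sum_sub_distrib]
  refine Finset.sum_congr rfl fun j _ => ?_
  simp only [Prod.fst_add, Prod.snd_add, Pi.add_apply]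
  ring

theorem polarBilin_split_single_left (m : ℕ) (i : Fin m) (y : (Fin m → F) × (Fin m → F)) :
    polarBilin (splitQuadraticForm F m) (Pi.single i 1, 0) y = y.2 i := by
  rw [polarBilin_splitQuadraticForm, Finset.sum_eq_single i]
  · simp
  · intro j _ hji
    simp [hji]
  · simp

theorem polarBilin_split_single_right (m : ℕ) (i : Fin m) (y : (Fin m → F) × (Fin m → F)) :
    polarBilin (splitQuadraticForm F m) (0, Pi.single i 1) y = y.1 i := by
  rw [polarBilin_splitQuadraticForm, Finset.sum_eq_single i]
  · simp
  · intro j _ hji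
    simp [hji]
  · simp

theorem separatingRight_splitQuadraticForm (m : ℕ) :
    (polarBilin (splitQuadraticForm F m)).SeparatingRight := by
  intro y hy
  refine Prod.ext (funext fun i => ?_) (funext fun i => ?_)
  · rw [← polarBilin_split_single_right, hy]
    rfl
  · rw [← polarBilin_split_single_left, hy]
    rfl

theorem exists_splitQuadraticForm_eq {m : ℕ} (hm : 0 < m) (c : F) :
    ∃ a, splitQuadraticForm F m a = c := by
  refine ⟨(Pi.single ⟨0, hm⟩ c, Pi.single ⟨0, hm⟩ 1), ?_⟩
  rw [splitQuadraticForm_apply, Finset.sum_eq_single ⟨0, hm⟩]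
  · simp
  · intro j _ hj
    simp [hj]
  · simp

/-- A quadratic form in at least three variables over a finite field is isotropic. -/
theorem exists_ne_zero_map_eq_zero_of_finite [Finite F] [FiniteDimensional F V]
    (Q : QuadraticForm F V) (hV : 2 < Module.finrank F V) : ∃ v ≠ 0, Q v = 0 := by
  have : Fintype F := Fintype.ofFinite F
  classical
  -- Chevalley–Warning: a possibly non-symmetric `B`, available also in characteristic two, presents
  -- `Q` as a polynomial of degree at most two in more than two variables. Its number of zeros is
  -- divisible by the characteristic, so `0` is not the only one.
  obtain ⟨B, rfl⟩ := LinearMap.BilinMap.toQuadraticMap_surjective Q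
  let b := Module.finBasis F V
  let n := Module.finrank F V
  let p : MvPolynomial (Fin n) F :=
    ∑ i, ∑ j, MvPolynomial.C (B (b i) (b j)) * (MvPolynomial.X i * MvPolynomial.X j)
  have hp : p.totalDegree < Fintype.card (Fin n) := by
    rw [Fintype.card_fin]
    refine lt_of_le_of_lt ?_ hV
    refine MvPolynomial.totalDegree_finsetSum_le fun i _ =>
      MvPolynomial.totalDegree_finsetSum_le fun j _ => ?_
    refine (MvPolynomial.totalDegree_mul _ _).trans ?_
    rw [MvPolynomial.totalDegree_C, zero_add]
    refine (MvPolynomial.totalDegree_mul _ _).trans ?_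
    rw [MvPolynomial.totalDegree_X, MvPolynomial.totalDegree_X]
  have heval : ∀ x : Fin n → F, MvPolynomial.eval x p =
      B.toQuadraticMap (b.equivFun.symm x) := by
    intro x
    rw [LinearMap.BilinMap.toQuadraticMap_apply, b.equivFun_symm_apply]
    simp only [p, map_sum, LinearMap.sum_apply, map_smul, LinearMap.smul_apply, map_mul,
      MvPolynomial.eval_C, MvPolynomial.eval_X, smul_eq_mul]
    rw [Finset.sum_comm]
    refine Finset.sum_congr rfl fun i _ => ?_
    rw [Finset.mul_sum]
    exact Finset.sum_congr rfl fun j _ => by ring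
  obtain ⟨q, hq⟩ := CharP.exists F
  have hdvd := char_dvd_card_solutions q hp
  have hq' : q.Prime := CharP.char_is_prime F q
  have hzero : MvPolynomial.eval (0 : Fin n → F) p = 0 := by
    rw [heval, map_zero, QuadraticMap.map_zero]
  have hcard : 1 < Fintype.card {x : Fin n → F // MvPolynomial.eval x p = 0} :=
    hq'.one_lt.trans_le (Nat.le_of_dvd (Fintype.card_pos_iff.2 ⟨⟨0, hzero⟩⟩) hdvd)
  obtain ⟨⟨x, hx⟩, hx0⟩ := Fintype.exists_ne_of_one_lt_card hcard ⟨0, hzero⟩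
  refine ⟨b.equivFun.symm x, fun h => hx0 (Subtype.ext ?_), by rw [← heval, hx]⟩
  exact b.equivFun.symm.map_eq_zero_iff.1 h

/-- The orthogonal decomposition determined by an isometric copy of a split space. -/
theorem exists_prodEquiv_of_split [FiniteDimensional F V] {Q : QuadraticForm F V} {m : ℕ}
    {ι : ((Fin m → F) × (Fin m → F)) →ₗ[F] V} (hι : ∀ x, Q (ι x) = splitQuadraticForm F m x) :
    ∃ (W : Submodule F V) (e : (((Fin m → F) × (Fin m → F)) × W) ≃ₗ[F] V),
      (∀ v, v ∈ W ↔ ∀ x, polarBilin Q (ι x) v = 0) ∧ ∀ x w, e (x, w) = ι x + w := by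
  refine exists_prodEquiv_orthogonal (σ := RingHom.id F) (polarBilin Q) ι fun y hy =>
    separatingRight_splitQuadraticForm m y fun x => ?_
  have h1 := hι (x + y)
  rw [map_add, map_add_eq_polarBilin, map_add_eq_polarBilin, hι, hι, hy] at h1
  exact (add_left_cancel h1).symm

/-- A copy of a split space with complement of dimension at least three can be enlarged. -/
theorem exists_split_succ [Finite F] [FiniteDimensional F V] {Q : QuadraticForm F V}
    (hQ : IsNonsingularQuadratic Q) {m : ℕ} {ι : ((Fin m → F) × (Fin m → F)) →ₗ[F] V}
    (hι : ∀ x, Q (ι x) = splitQuadraticForm F m x) {W : Submodule F V}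
    {e : (((Fin m → F) × (Fin m → F)) × W) ≃ₗ[F] V}
    (hW : ∀ v, v ∈ W ↔ ∀ x, polarBilin Q (ι x) v = 0) (he : ∀ x w, e (x, w) = ι x + w)
    (hdim : 2 < Module.finrank F W) :
    ∃ ι' : ((Fin (m + 1) → F) × (Fin (m + 1) → F)) →ₗ[F] V,
      ∀ x, Q (ι' x) = splitQuadraticForm F (m + 1) x := by
  obtain ⟨w, hw0, hQw⟩ := exists_ne_zero_map_eq_zero_of_finite (Q.comp W.subtype) hdim
  replace hQw : Q w = 0 := hQw
  obtain ⟨u, hu⟩ : ∃ u : W, polarBilin Q w u ≠ 0 := by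
    by_contra! hcon
    -- Being already orthogonal to the split part, a singular `w` orthogonal to `W` would lie in the
    -- radical of `Q`.
    have h1 : (w : V) ∈ Q.radical := by
      refine QuadraticMap.mem_radical_iff'.2 ⟨hQw, fun v => ?_⟩
      obtain ⟨⟨x, u⟩, rfl⟩ := e.surjective v
      rw [map_add_eq_polarBilin, he, map_add (polarBilin Q (w : V)), hcon, polarBilin_comm,
        (hW w).1 w.2, hQw, zero_add, add_zero, add_zero]
    rw [hQ, Submodule.mem_bot] at h1
    exact hw0 (Subtype.ext h1)
  obtain ⟨f, hwf, hQf⟩ : ∃ f : W, polarBilin Q w f = 1 ∧ Q f = 0 := by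
    set c := (polarBilin Q (w : V) u)⁻¹ with hc
    have h1 : polarBilin Q (w : V) (c • (u : V)) = 1 := by
      rw [map_smul, smul_eq_mul, hc, inv_mul_cancel₀ hu]
    have h2 : polarBilin Q (w : V) w = 0 := by rw [polarBilin_self, hQw, mul_zero]
    -- Subtracting `Q(c u) w` makes `c u` singular without changing its pairing with the singular
    -- vector `w`.
    refine ⟨c • u + (-Q (c • (u : V))) • w, ?_, ?_⟩
    · rw [Submodule.coe_add, Submodule.coe_smul, Submodule.coe_smul, map_add, h1, map_smul, h2,
        smul_zero, add_zero]
    · rw [Submodule.coe_add, Submodule.coe_smul, Submodule.coe_smul, map_add_smul, hQw,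
        polarBilin_comm, h1]
      ring
  let E' := (Fin (m + 1) → F) × (Fin (m + 1) → F)
  let x₀ : E' →ₗ[F] F := LinearMap.proj 0 ∘ₗ LinearMap.fst F _ _
  let y₀ : E' →ₗ[F] F := LinearMap.proj 0 ∘ₗ LinearMap.snd F _ _
  let tail : E' →ₗ[F] (Fin m → F) × (Fin m → F) :=
    (LinearMap.funLeft F F Fin.succ).prodMap (LinearMap.funLeft F F Fin.succ)
  refine ⟨ι ∘ₗ tail + x₀.smulRight (w : V) + y₀.smulRight (f : V), fun x => ?_⟩
  have h1 : (ι ∘ₗ tail + x₀.smulRight (w : V) + y₀.smulRight (f : V)) x =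
      ι (tail x) + x.1 0 • (w : V) + x.2 0 • (f : V) := rfl
  rw [h1, map_add_smul, map_add_smul, map_add, LinearMap.add_apply, (hW w).1 w.2, (hW f).1 f.2,
    hι, hQw, hQf, map_smul, LinearMap.smul_apply, hwf, splitQuadraticForm_apply,
    splitQuadraticForm_apply, Fin.sum_univ_succ]
  have h2 : ∀ j, (tail x).1 j = x.1 j.succ ∧ (tail x).2 j = x.2 j.succ := fun j => ⟨rfl, rfl⟩
  simp only [h2, smul_eq_mul]
  ring

/-- A nonsingular quadratic form over a finite field is the sum of a split form and a form in at
most two variables. -/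
theorem exists_quadratic_decomposition [Finite F] [FiniteDimensional F V] {Q : QuadraticForm F V}
    (hQ : IsNonsingularQuadratic Q) :
    ∃ (m : ℕ) (W : Submodule F V) (e : (((Fin m → F) × (Fin m → F)) × W) ≃ₗ[F] V),
      Module.finrank F W ≤ 2 ∧
      ∀ x w, Q (e (x, w)) = splitQuadraticForm F m x + Q.comp W.subtype w := by
  -- If the complement always had dimension above two, split subspaces would grow beyond `dim V`.
  by_contra! hcon
  have key : ∀ m : ℕ, ∃ ι : ((Fin m → F) × (Fin m → F)) →ₗ[F] V,
      ∀ x, Q (ι x) = splitQuadraticForm F m x := by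
    intro m
    induction m with
    | zero => exact ⟨0, fun x => by simp [splitQuadraticForm_apply]⟩
    | succ m ih =>
      obtain ⟨ι, hι⟩ := ih
      obtain ⟨W, e, hW, he⟩ := exists_prodEquiv_of_split hι
      refine exists_split_succ hQ hι hW he (lt_of_not_ge fun hdim => ?_)
      obtain ⟨x, w, hxw⟩ := hcon m W e hdim
      refine hxw ?_
      rw [he, map_add_eq_polarBilin, hι, (hW w).1 w.2, add_zero]
      rfl
  obtain ⟨ι, hι⟩ := key (Module.finrank F V + 1)
  obtain ⟨W, e, -⟩ := exists_prodEquiv_of_split hι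
  have h1 := e.finrank_eq
  rw [Module.finrank_prod, Module.finrank_prod, Module.finrank_fin_fun] at h1
  omega

end Split

/-! ### Metric ultraproducts of orthogonal groups -/

theorem exists_pOmegaPlus_ultraproduct {ω : Ultrafilter ℕ} (F : ℕ → Type*) [∀ i, Field (F i)]
    [∀ i, Finite (F i)] (V : ℕ → Type*) [∀ i, AddCommGroup (V i)] [∀ i, Module (F i) (V i)]
    [∀ i, FiniteDimensional (F i) (V i)] (Q : ∀ i, QuadraticForm (F i) (V i))
    (hQ : ∀ i, IsNonsingularQuadratic (Q i))
    (hV : Tendsto (fun i => Module.finrank (F i) (V i)) ω atTop) :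
    ∃ m : ℕ → ℕ, Tendsto m ω atTop ∧
      ∃ e : MetricUltraproduct ω (fun i => POmega (Q i)) ≃*
        MetricUltraproduct ω (fun i => POmegaPlus (F i) (m i)), Isometry e := by
  choose m W e hW he using fun i => exists_quadratic_decomposition (hQ i)
  have hdim : ∀ i, Module.finrank (F i) (V i) = m i + m i + Module.finrank (F i) (W i) :=
    fun i => by
      rw [← (e i).finrank_eq, Module.finrank_prod, Module.finrank_prod, Module.finrank_fin_fun]
  have hm : Tendsto m ω atTop := by
    refine tendsto_atTop.2 fun N => ?_
    filter_upwards [hV.eventually_ge_atTop (2 * N + 2)] with i hi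
    have h1 := hdim i
    have h2 := hW i
    omega
  refine ⟨m, hm, ?_⟩
  -- The constant is `10 = 2 * 2 + 6`, as `dim W ≤ 2`.
  refine exists_isometric_mulEquiv_map_mk e (fun i => omegaSubgroup (splitQuadraticForm (F i) (m i)))
    (fun i => omegaSubgroup (Q i)) (fun i g hg => extendGL_mem_omegaSubgroup (he i) hg) 10 ?_
    (fun i => (hW i).trans (by norm_num)) ?_
  · refine tendsto_atTop_mono (fun i => ?_) hm
    rw [Module.finrank_prod, Module.finrank_fin_fun]
    omega
  -- `m ≥ 3` gives `2 m > 4` and room for two hyperbolic pairs.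
  · filter_upwards [hm.eventually_ge_atTop 3] with i hi g hg
    let j₀ : Fin (m i) := ⟨0, by omega⟩
    let j₁ : Fin (m i) := ⟨1, by omega⟩
    have hj : j₁ ≠ j₀ := fun h => absurd (congrArg Fin.val h) one_ne_zero
    obtain ⟨a, ha, hag⟩ := exists_omega_projRankDist_le
      (QE := splitQuadraticForm (F i) (m i)) (separatingRight_splitQuadraticForm (m i))
      (by rw [Module.finrank_prod, Module.finrank_fin_fun]; omega)
      (exists_splitQuadraticForm_eq (by omega))
      (e₁ := (Pi.single j₀ 1, 0)) (f₁ := (0, Pi.single j₀ 1))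
      (e₂ := (Pi.single j₁ 1, 0)) (f₂ := (0, Pi.single j₁ 1))
      (by simp [splitQuadraticForm_apply]) (by simp [splitQuadraticForm_apply])
      (by rw [polarBilin_split_single_left]; simp) (by rw [polarBilin_split_single_left]; simp)
      (by rw [polarBilin_split_single_left]; simp)
      (by rw [polarBilin_split_single_left]; simp [hj.symm])
      (by rw [polarBilin_split_single_right]; simp [hj.symm])
      (by rw [polarBilin_split_single_right]; simp)
      (he i) (g := g) (Subgroup.commutator_le_self _ hg)
    refine ⟨a, ha, hag.trans ?_⟩
    have := hW i
    gcongr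
    omega

theorem proposition4p3 (ω : Ultrafilter ℕ) (_hω : (ω : Filter ℕ) ≤ Filter.cofinite) :
    -- (a) unitary groups
    (∀ (F : ℕ → Type*) [∀ i, Field (F i)] [∀ i, StarRing (F i)]
      (V : ℕ → Type*) [∀ i, AddCommGroup (V i)] [∀ i, Module (F i) (V i)]
      [∀ i, FiniteDimensional (F i) (V i)]
      (h : ∀ i, V i →ₗ⋆[F i] V i →ₗ[F i] F i),
      (∀ i, ∃ a : F i, star a ≠ a) →
      (∀ i, IsNonsingularHermitian (h i)) →
      Tendsto (fun i => Module.finrank (F i) (V i)) ω atTop →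
      ∃ (m : ℕ → ℕ) (h' : ∀ i, (Fin (m i) → F i) →ₗ⋆[F i] (Fin (m i) → F i) →ₗ[F i] F i),
        (∀ i, Even (m i)) ∧
        Tendsto m ω atTop ∧
        (∀ i, IsNonsingularHermitian (h' i)) ∧
        (∀ i, Finite (F i) → h' i = standardHermitianForm (F i) (m i)) ∧
        ∃ e : MetricUltraproduct ω (fun i => PSU (h i)) ≃*
            MetricUltraproduct ω (fun i => PSU (h' i)),
          Isometry e) ∧
    -- (b) orthogonal groups
    (∀ (F : ℕ → Type*) [∀ i, Field (F i)] [∀ i, Finite (F i)]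
      (V : ℕ → Type*) [∀ i, AddCommGroup (V i)] [∀ i, Module (F i) (V i)]
      [∀ i, FiniteDimensional (F i) (V i)]
      (Q : ∀ i, QuadraticForm (F i) (V i)),
      (∀ i, IsNonsingularQuadratic (Q i)) →
      Tendsto (fun i => Module.finrank (F i) (V i)) ω atTop →
      ∃ m : ℕ → ℕ,
        Tendsto m ω atTop ∧
        ∃ e : MetricUltraproduct ω (fun i => POmega (Q i)) ≃*
            MetricUltraproduct ω (fun i => POmegaPlus (F i) (m i)),
          Isometry e) := by
  refine ⟨?_, ?_⟩
  · intro F _ _ V _ _ _ h hF hh hV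
    exact exists_even_psu_ultraproduct F V h hF hh hV
  · intro F _ _ V _ _ _ Q hQ hV
    exact exists_pOmegaPlus_ultraproduct F V Q hQ hV
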